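/- Let $(M,g)$ be a spacetime, i.e. a smooth four-dimensional Hausdorff manifold $M$ with a smooth Lorentzian metric $g$ of signature $(-,+,+,+)$ and a time orientation. Let $U\subseteq M$ be an open set that is globally conformally flat: there are a single smooth function $\Omega:U\to(0,\infty)$ and a smooth flat Lorentzian metric $\eta$ on $U$ (vanishing Riemann tensor) with $g=\Omega^2\eta$ on $U$. Then no truncated future wandering null geodesic of $(M,g)$ is contained in $U$. Here a point $\gamma(b)$ of a geodesic $\gamma$ is conjugate to $\gamma(a)$ along $\gamma$, $a\neq b$, if some Jacobi field along $\gamma$ (a solution of the geodesic deviation equation $\frac{D^2J}{ds^2}=-R(J,\gamma')\gamma'$) that is not identically zero vanishes at $a$ and at $b$. A future wandering null geodesic from $p$ is a future-directed null geodesic $\gamma:[0,\infty)\to M$ with $\gamma(0)=p$, affinely parametrized and complete (hence inextendible) to the future, along which there are infinitely many parameters $t>0$ with $\gamma(t)$ conjugate to $p$. If $t_1>0$ is the first of these parameters, the restriction of $\gamma$ to $[t_1,\infty)$ is called a truncated future wandering null geodesic. -/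

import Mathlib

open Set
open scoped Manifold ContDiff

noncomputable section

/-- The model space of a four-dimensional spacetime manifold. -/
abbrev E4 : Type := EuclideanSpace ℝ (Fin 4)

/-! ### Tensor calculus in coordinates: a field of bilinear forms `G` on `E4` -/

/-- The Christoffel symbols of the first kind, as the covector
`z ↦ ½ (∂_v G(w, z) + ∂_w G(v, z) - ∂_z G(v, w))`. -/
def christoffelLower (G : E4 → E4 →L[ℝ] E4 →L[ℝ] ℝ) (y v w : E4) : E4 →L[ℝ] ℝ :=
  (1 / 2 : ℝ) • (fderiv ℝ G y v w + fderiv ℝ G y w v - ((fderiv ℝ G y).flip v).flip w)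

/-- The Christoffel symbols `Γ(v, w)` of the Levi-Civita connection: the index of
`christoffelLower` is raised with the inverse of `v ↦ G(v, ·)`. -/
def christoffel (G : E4 → E4 →L[ℝ] E4 →L[ℝ] ℝ) (y v w : E4) : E4 :=
  (G y).inverse (christoffelLower G y v w)

/-- The Riemann tensor `R(u, v) w = ∇_u ∇_v w - ∇_v ∇_u w`, for `u v w` constant in coordinates. -/
def riemann (G : E4 → E4 →L[ℝ] E4 →L[ℝ] ℝ) (y u v w : E4) : E4 :=
  fderiv ℝ (fun z => christoffel G z v w) y u - fderiv ℝ (fun z => christoffel G z u w) y v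
    + christoffel G y u (christoffel G y v w) - christoffel G y v (christoffel G y u w)

variable {M : Type*} [TopologicalSpace M] [ChartedSpace E4 M]

/-! ### Fields of bilinear forms on a manifold -/

variable (M) in
/-- A field of bilinear forms on the tangent spaces of `M` (no regularity yet). -/
abbrev FormField : Type _ :=
  ∀ x : M, TangentSpace 𝓘(ℝ, E4) x →L[ℝ] TangentSpace 𝓘(ℝ, E4) x →L[ℝ] ℝ

/-- The components of a tangent vector `v` at `x` in the chart `φ`. -/
def toChart (φ : OpenPartialHomeomorph M E4) (x : M) (v : TangentSpace 𝓘(ℝ, E4) x) : E4 :=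
  mfderiv 𝓘(ℝ, E4) 𝓘(ℝ, E4) φ x v

/-- The components of a field of bilinear forms in the chart `φ`, as a function of the
coordinates. -/
def coordForm (h : FormField M) (φ : OpenPartialHomeomorph M E4) (y : E4) :
    E4 →L[ℝ] E4 →L[ℝ] ℝ :=
  ContinuousLinearMap.bilinearComp (E := E4) (F := E4) (h (φ.symm y))
    (mfderiv 𝓘(ℝ, E4) 𝓘(ℝ, E4) φ.symm y) (mfderiv 𝓘(ℝ, E4) 𝓘(ℝ, E4) φ.symm y)

/-- `h` is a smooth Lorentzian metric, of signature `(-,+,+,+)`, on the open set `U`. -/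
structure IsLorentzianOn (h : FormField M) (U : Set M) : Prop where
  smooth : ∀ φ ∈ atlas E4 M, ContDiffOn ℝ ∞ (coordForm h φ) (φ.target ∩ φ.symm ⁻¹' U)
  symm : ∀ x ∈ U, ∀ v w, h x v w = h x w v
  signature : ∀ x ∈ U, ∃ e : Module.Basis (Fin 4) ℝ (TangentSpace 𝓘(ℝ, E4) x),
    ∀ i j, h x (e i) (e j) = if i = j then (if i = 0 then -1 else 1) else 0

/-- `h` is flat on the open set `U`: its Riemann tensor vanishes there. -/
def IsFlatOn (h : FormField M) (U : Set M) : Prop :=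
  ∀ φ ∈ atlas E4 M, ∀ x ∈ U ∩ φ.source, ∀ u v w : E4, riemann (coordForm h φ) (φ x) u v w = 0

/-- On `U` the field `g` is `Ω²` times a flat Lorentzian metric, for a single smooth positive
function `Ω` on all of `U`. -/
def IsGloballyConformallyFlatOn (g : FormField M) (U : Set M) : Prop :=
  ∃ (Ω : M → ℝ) (η : FormField M),
    ContMDiffOn 𝓘(ℝ, E4) 𝓘(ℝ, ℝ) ∞ Ω U ∧ (∀ x ∈ U, 0 < Ω x) ∧
    IsLorentzianOn η U ∧ IsFlatOn η U ∧ ∀ x ∈ U, g x = (Ω x) ^ 2 • η x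

/-! ### Geodesics, Jacobi fields and conjugate points

Curves are maps `γ : ℝ → M` of which only the values on an interval `I` matter; derivatives are
taken within `I`. -/

/-- The velocity of `γ` at the parameter `t`. -/
def velocity (γ : ℝ → M) (I : Set ℝ) (t : ℝ) : TangentSpace 𝓘(ℝ, E4) (γ t) :=
  mfderivWithin 𝓘(ℝ, ℝ) 𝓘(ℝ, E4) γ I t (1 : ℝ)

/-- The vector field `W` along `γ` is the Levi-Civita covariant derivative of the vector field `V`
along `γ`: in every chart, `W = V' + Γ(γ', V)`. -/
def IsCovariantDerivAlong (h : FormField M) (γ : ℝ → M) (I : Set ℝ)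
    (V W : ∀ t, TangentSpace 𝓘(ℝ, E4) (γ t)) : Prop :=
  ∀ φ ∈ atlas E4 M, ∀ t ∈ I, γ t ∈ φ.source →
    HasDerivWithinAt (fun s => toChart φ (γ s) (V s))
      (toChart φ (γ t) (W t) - christoffel (coordForm h φ) (φ (γ t))
        (toChart φ (γ t) (velocity γ I t)) (toChart φ (γ t) (V t))) I t

/-- `γ` is an affinely parametrized geodesic on the interval `I`. -/
def IsGeodesicOn (h : FormField M) (γ : ℝ → M) (I : Set ℝ) : Prop :=
  ContMDiffOn 𝓘(ℝ, ℝ) 𝓘(ℝ, E4) ∞ γ I ∧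
    IsCovariantDerivAlong h γ I (velocity γ I) (fun _ => 0)

/-- `J` is a Jacobi field along `γ`, that is, a solution of the geodesic deviation equation
`D² J = - R(J, γ') γ'`. -/
def IsJacobiField (h : FormField M) (γ : ℝ → M) (I : Set ℝ)
    (J : ∀ t, TangentSpace 𝓘(ℝ, E4) (γ t)) : Prop :=
  ∃ DJ DDJ : ∀ t, TangentSpace 𝓘(ℝ, E4) (γ t),
    IsCovariantDerivAlong h γ I J DJ ∧ IsCovariantDerivAlong h γ I DJ DDJ ∧
    ∀ φ ∈ atlas E4 M, ∀ t ∈ I, γ t ∈ φ.source →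
      toChart φ (γ t) (DDJ t) =
        - riemann (coordForm h φ) (φ (γ t)) (toChart φ (γ t) (J t))
            (toChart φ (γ t) (velocity γ I t)) (toChart φ (γ t) (velocity γ I t))

/-- `γ b` is conjugate to `γ a` along `γ`: some Jacobi field that is not identically zero vanishes
at the two distinct parameters `a` and `b`. -/
def IsConjugate (h : FormField M) (γ : ℝ → M) (I : Set ℝ) (a b : ℝ) : Prop :=
  a ∈ I ∧ b ∈ I ∧ a ≠ b ∧ ∃ J : ∀ t, TangentSpace 𝓘(ℝ, E4) (γ t),
    IsJacobiField h γ I J ∧ J a = 0 ∧ J b = 0 ∧ ∃ t ∈ I, J t ≠ 0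

/-! ### Spacetimes and wandering null geodesics -/

variable [IsManifold 𝓘(ℝ, E4) ∞ M]

variable (M) in
/-- A time-oriented Lorentzian metric on `M`; the time orientation is given by a continuous
timelike vector field, declared to be future-directed. -/
structure Spacetime where
  metric : FormField M
  lorentzian : IsLorentzianOn metric univ
  timeField : ∀ x : M, TangentSpace 𝓘(ℝ, E4) x
  continuous_timeField : Continuous fun x => (⟨x, timeField x⟩ : TangentBundle 𝓘(ℝ, E4) M)
  timelike_timeField : ∀ x, metric x (timeField x) (timeField x) < 0

/-- The future-directed, future-complete null geodesics with starting point `γ 0`. Completeness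
means that the affine parameter runs through all of `[0, ∞)`; such a geodesic is inextendible to
the future. -/
structure IsCompleteFutureNullGeodesic (S : Spacetime M) (γ : ℝ → M) : Prop where
  geodesic : IsGeodesicOn S.metric γ (Ici 0)
  null : ∀ t ∈ Ici (0 : ℝ), S.metric (γ t) (velocity γ (Ici 0) t) (velocity γ (Ici 0) t) = 0
  future : ∀ t ∈ Ici (0 : ℝ), S.metric (γ t) (velocity γ (Ici 0) t) (S.timeField (γ t)) < 0

/-- The parameters of the points of `γ` that are conjugate to its starting point `γ 0`. -/
def conjugateParams (S : Spacetime M) (γ : ℝ → M) : Set ℝ :=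
  {t | IsConjugate S.metric γ (Ici 0) 0 t}

/-- A future wandering null geodesic from `γ 0`: a complete future-directed null geodesic with an
unlimited number of conjugate points. -/
def IsFutureWandering (S : Spacetime M) (γ : ℝ → M) : Prop :=
  IsCompleteFutureNullGeodesic S γ ∧ (conjugateParams S γ).Infinite

/-- `σ`, parametrized by `[0, ∞)`, is a truncated future wandering null geodesic: what remains of a
future wandering null geodesic `γ` when the segment from its starting point to its first conjugate
point is discarded. -/
def IsTruncatedFutureWandering (S : Spacetime M) (σ : ℝ → M) : Prop :=
  ∃ (γ : ℝ → M) (t₁ : ℝ), IsFutureWandering S γ ∧ IsLeast (conjugateParams S γ) t₁ ∧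
    ∀ s ∈ Ici (0 : ℝ), σ s = γ (t₁ + s)

end

/-!
Let `k = γ'` be the velocity of a null geodesic. A Jacobi field vanishing at two parameters is
orthogonal to `k`. If `g = Ω² η` with `η` flat, the tidal operator `v ↦ R(v, k) k` on `k^⊥` is,
modulo `k`, the scalar `-w''/w`, where `w = Ω ∘ γ > 0`; hence the field `V = w J' - w' J` attached
to a normal Jacobi field `J` is parallel modulo `k`. Suppose that Jacobi fields `Jᵢ` vanish at a
common parameter and at the further distinct parameters `τᵢ`. The function `⟨Vᵢ, Jⱼ⟩ / w` vanishes
at `τⱼ`, and also at `τᵢ` because `⟨Jᵢ', Jⱼ⟩ = ⟨Jᵢ, Jⱼ'⟩`; its derivative is `⟨Vᵢ, Vⱼ⟩ / w²` with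
`⟨Vᵢ, Vⱼ⟩` constant, so Rolle's theorem gives `⟨Vᵢ, Vⱼ⟩ = 0`. As `k^⊥ / k` is positive definite of
dimension two, one of any three pairwise orthogonal `Vᵢ` is a multiple of `k`; then `Jᵢ'(τᵢ) = β k`
for some `β`, so `Jᵢ = β (t - τᵢ) k` by uniqueness, and the common zero forces `β = 0`. Hence at
most two points of the geodesic in `U` are conjugate to a given one.
-/

set_option maxSynthPendingDepth 3

noncomputable section

open scoped Topology

/-! ### Differential equations on real intervals -/

section RealInterval

variable {I : Set ℝ} {a b : ℝ}

theorem eq_of_hasDerivWithinAt_zero {E : Type*} [NormedAddCommGroup E] [NormedSpace ℝ E]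
    {f : ℝ → E} (hI : Convex ℝ I) (hf : ∀ t ∈ I, HasDerivWithinAt f 0 I t) (ha : a ∈ I)
    (hb : b ∈ I) : f a = f b := by
  simpa [sub_eq_zero] using
    hI.norm_image_sub_le_of_norm_hasDerivWithin_le (C := 0) hf (by simp) hb ha

theorem exists_hasDerivWithinAt_eq_zero {f f' : ℝ → ℝ} (hI : Convex ℝ I)
    (hf : ∀ t ∈ I, HasDerivWithinAt f (f' t) I t) (ha : a ∈ I) (hb : b ∈ I) (hab : a ≠ b)
    (hfab : f a = f b) : ∃ c ∈ I, f' c = 0 := by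
  wlog hlt : a < b generalizing a b
  · exact this hb ha hab.symm hfab.symm (hab.lt_or_gt.resolve_left hlt)
  have hsub : Icc a b ⊆ I := hI.ordConnected.out ha hb
  obtain ⟨c, hc, hfc⟩ := exists_hasDerivAt_eq_zero hlt
    (fun t ht => (hf t (hsub ht)).continuousWithinAt.mono hsub) hfab
    (fun t ht => (hf t (hsub (Ioo_subset_Icc_self ht))).hasDerivAt
      (Filter.mem_of_superset (Icc_mem_nhds ht.1 ht.2) hsub))
  exact ⟨c, hsub (Ioo_subset_Icc_self hc), hfc⟩

theorem eq_zero_of_hasDerivWithinAt_clm_apply {E : Type*} [NormedAddCommGroup E] [NormedSpace ℝ E]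
    {A : ℝ → E →L[ℝ] E} {X : ℝ → E} (hI : I.OrdConnected) {K : ℝ} (hA : ∀ t ∈ I, ‖A t‖ ≤ K)
    (hX : ∀ t ∈ I, HasDerivWithinAt X (A t (X t)) I t) (ha : a ∈ I) (hb : b ∈ I) (h0 : X a = 0) :
    X b = 0 := by
  have hlip : ∀ t ∈ I, LipschitzOnWith K.toNNReal (A t) univ := fun t ht =>
    ((A t).lipschitz.weaken (by
      rw [← NNReal.coe_le_coe, coe_nnnorm]
      exact (hA t ht).trans (Real.le_coe_toNNReal K))).lipschitzOnWith
  have hcont : ContinuousOn X I := fun t ht => (hX t ht).continuousWithinAt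
  rcases le_total a b with hab | hba
  · have hsub : Icc a b ⊆ I := hI.out ha hb
    exact ODE_solution_unique_of_mem_Icc_right (s := fun _ => univ) (g := fun _ => 0)
      (fun t ht => hlip t (hsub (Ico_subset_Icc_self ht))) (hcont.mono hsub)
      (fun t ht => (hX t (hsub (Ico_subset_Icc_self ht))).mono_of_mem_nhdsWithin
        (Filter.mem_of_superset (Icc_mem_nhdsGE_of_mem ht) hsub))
      (fun _ _ => mem_univ _) continuousOn_const
      (fun t _ => by simpa using hasDerivWithinAt_const t (Ici t) (0 : E))
      (fun _ _ => mem_univ _) h0 (right_mem_Icc.2 hab)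
  · have hsub : Icc b a ⊆ I := hI.out hb ha
    exact ODE_solution_unique_of_mem_Icc_left (s := fun _ => univ) (g := fun _ => 0)
      (fun t ht => hlip t (hsub (Ioc_subset_Icc_self ht))) (hcont.mono hsub)
      (fun t ht => (hX t (hsub (Ioc_subset_Icc_self ht))).mono_of_mem_nhdsWithin
        (Filter.mem_of_superset (Icc_mem_nhdsLE_of_mem ht) hsub))
      (fun _ _ => mem_univ _) continuousOn_const
      (fun t _ => by simpa using hasDerivWithinAt_const t (Iic t) (0 : E))
      (fun _ _ => mem_univ _) h0 (left_mem_Icc.2 hba)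

theorem eventually_eq_zero_iff_of_hasDerivWithinAt_clm_apply {E : Type*} [NormedAddCommGroup E]
    [NormedSpace ℝ E] {A : ℝ → E →L[ℝ] E} {X : ℝ → E} (hI : I.OrdConnected) (ha : a ∈ I)
    (hA : ContinuousWithinAt A I a)
    (hX : ∀ᶠ s in 𝓝[I] a, HasDerivWithinAt X (A s (X s)) I s) :
    ∀ᶠ s in 𝓝[I] a, X s = 0 ↔ X a = 0 := by
  have hbound : ∀ᶠ s in 𝓝[I] a, ‖A s‖ ≤ ‖A a‖ + 1 :=
    (hA.norm.eventually_lt_const (lt_add_one _)).mono fun _ => le_of_lt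
  obtain ⟨ε, hε, hball⟩ := Metric.mem_nhdsWithin_iff.1 (hbound.and hX)
  have hN : (Metric.ball a ε ∩ I).OrdConnected := by
    rw [Real.ball_eq_Ioo]
    exact ordConnected_Ioo.inter hI
  have haN : a ∈ Metric.ball a ε ∩ I := ⟨Metric.mem_ball_self hε, ha⟩
  have hNA : ∀ s ∈ Metric.ball a ε ∩ I, ‖A s‖ ≤ ‖A a‖ + 1 := fun s hs => (hball hs).1
  have hNX : ∀ s ∈ Metric.ball a ε ∩ I, HasDerivWithinAt X (A s (X s)) (Metric.ball a ε ∩ I) s :=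
    fun s hs => (hball hs).2.mono inter_subset_right
  filter_upwards [inter_mem_nhdsWithin I (Metric.ball_mem_nhds a hε)] with s hs
  exact ⟨eq_zero_of_hasDerivWithinAt_clm_apply hN hNA hNX hs.symm haN,
    eq_zero_of_hasDerivWithinAt_clm_apply hN hNA hNX haN hs.symm⟩

theorem hasDerivWithinAt_derivWithin_comp {E : Type*} [NormedAddCommGroup E] [NormedSpace ℝ E]
    {F : E → ℝ} {c k : ℝ → E} {k' : E} {t : ℝ} (hI : UniqueDiffOn ℝ I) (ht : t ∈ I)
    (hF : ContDiffAt ℝ 2 F (c t)) (hc : ∀ᶠ s in 𝓝[I] t, HasDerivWithinAt c (k s) I s)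
    (hk : HasDerivWithinAt k k' I t) :
    HasDerivWithinAt (derivWithin (fun s => F (c s)) I)
      (fderiv ℝ (fderiv ℝ F) (c t) (k t) (k t) + fderiv ℝ F (c t) k') I t := by
  have hct : HasDerivWithinAt c (k t) I t := hc.self_of_nhdsWithin ht
  have hFev : ∀ᶠ s in 𝓝[I] t, DifferentiableAt ℝ F (c s) :=
    hct.continuousWithinAt.eventually
      ((hF.eventually (by simp)).mono fun z hz => hz.differentiableAt (by simp))
  have hderiv : derivWithin (fun s => F (c s)) I =ᶠ[𝓝[I] t] fun s => fderiv ℝ F (c s) (k s) := by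
    filter_upwards [hc, hFev, self_mem_nhdsWithin] with s hcs hFs hs
    exact (hFs.hasFDerivAt.comp_hasDerivWithinAt s hcs).derivWithin (hI s hs)
  have hF' : DifferentiableAt ℝ (fderiv ℝ F) (c t) :=
    (hF.fderiv_right (m := 1) (by norm_num)).differentiableAt (by simp)
  exact ((hF'.hasFDerivAt.comp_hasDerivWithinAt t hct).clm_apply hk).congr_of_eventuallyEq hderiv
    (hderiv.self_of_nhdsWithin ht)

end RealInterval

/-! ### Bilinear forms and null vectors -/

theorem isInvertible_of_separating {𝕜 E : Type*} [NontriviallyNormedField 𝕜] [CompleteSpace 𝕜]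
    [NormedAddCommGroup E] [NormedSpace 𝕜 E] [FiniteDimensional 𝕜 E] {B : E →L[𝕜] E →L[𝕜] 𝕜}
    (hB : ∀ v, (∀ w, B v w = 0) → v = 0) : B.IsInvertible := by
  have hinj : Function.Injective B := (injective_iff_map_eq_zero B).2 fun v hv =>
    hB v fun w => by rw [hv, _root_.zero_apply]
  have : FiniteDimensional 𝕜 (E →L[𝕜] 𝕜) :=
    (LinearMap.toContinuousLinearMap (𝕜 := 𝕜) (E := E) (F' := 𝕜)).finiteDimensional
  have hdim : Module.finrank 𝕜 E = Module.finrank 𝕜 (E →L[𝕜] 𝕜) := by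
    rw [← (LinearMap.toContinuousLinearMap (𝕜 := 𝕜) (E := E) (F' := 𝕜)).finrank_eq]
    exact Subspace.dual_finrank_eq.symm
  exact ⟨(LinearEquiv.ofInjectiveOfFinrankEq (B : E →ₗ[𝕜] E →L[𝕜] 𝕜) hinj
    hdim).toContinuousLinearEquiv, rfl⟩

section BilinForm

theorem exists_apply_self_eq_zero_of_isOrthoᵢ {𝕜 V : Type*} [Field 𝕜] [AddCommGroup V] [Module 𝕜 V]
    {B : LinearMap.BilinForm 𝕜 V} {n : ℕ} {k : V} (hB : B.SeparatingLeft)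
    (hn : Module.finrank 𝕜 V = n + 1) (hk0 : k ≠ 0) (hk : B k k = 0) {v : Fin n → V}
    (hkv : ∀ i, B k (v i) = 0) (hv : B.IsOrthoᵢ v) : ∃ i, B (v i) (v i) = 0 := by
  by_contra! hne
  have hk_span : k ∉ Submodule.span 𝕜 (range v) := by
    rw [Submodule.mem_span_range_iff_exists_fun]
    rintro ⟨c, rfl⟩
    refine hk0 (Finset.sum_eq_zero fun i _ => ?_)
    have hci : c i * B (v i) (v i) = 0 := by
      have := hkv i
      rwa [map_sum, LinearMap.sum_apply, Finset.sum_eq_single i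
        (fun j _ hj => by simp [LinearMap.isOrthoᵢ_def.1 hv j i hj]) (by simp), map_smul,
        LinearMap.smul_apply, smul_eq_mul] at this
    rw [(mul_eq_zero.1 hci).resolve_right (hne i), zero_smul]
  have hli : LinearIndependent 𝕜 (Fin.cons k v : Fin (n + 1) → V) :=
    linearIndependent_finCons.2 ⟨LinearMap.linearIndependent_of_isOrthoᵢ hv hne, hk_span⟩
  have hBk : B k = 0 := LinearMap.ext_on_range
    (hli.span_eq_top_of_card_eq_finrank (by rw [Fintype.card_fin, hn])) fun i => by
      refine Fin.cases ?_ (fun j => ?_) i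
      · simpa using hk
      · simpa using hkv j
  exact hk0 (hB k fun w => by rw [hBk, LinearMap.zero_apply])

variable {V : Type*} [AddCommGroup V] [Module ℝ V] {B : LinearMap.BilinForm ℝ V} {n : ℕ} {k v : V}

/-- `e` is an orthonormal basis for the form `B` of signature `(-,+,…,+)`, the vector `e 0` being
the timelike one. -/
def IsLorentzBasis (B : LinearMap.BilinForm ℝ V) (e : Module.Basis (Fin (n + 1)) ℝ V) : Prop :=
  ∀ i j, B (e i) (e j) = if i = j then (if i = 0 then -1 else 1) else 0

namespace IsLorentzBasis

variable {e : Module.Basis (Fin (n + 1)) ℝ V}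

theorem separatingLeft (he : IsLorentzBasis B e) : B.SeparatingLeft := by
  refine LinearMap.IsOrthoᵢ.separatingLeft_of_not_isOrtho_basis_self e
    (LinearMap.isOrthoᵢ_def.2 fun i j hij => by rw [he, if_neg hij]) fun i hi => ?_
  rw [he, if_pos rfl] at hi
  split_ifs at hi <;> norm_num at hi

theorem apply_self (he : IsLorentzBasis B e) (v : V) :
    B v v = -e.repr v 0 ^ 2 + ∑ i : Fin n, e.repr v i.succ ^ 2 := by
  conv_lhs => rw [← e.sum_repr v]
  simp only [map_sum, LinearMap.sum_apply, map_smul, LinearMap.smul_apply, he _ _]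
  simp [Fin.sum_univ_succ, Fin.succ_ne_zero, sq]

theorem eq_zero_of_null (he : IsLorentzBasis B e) (hv : B v v = 0) (hv0 : e.repr v 0 = 0) :
    v = 0 := by
  rw [he.apply_self, hv0, zero_pow two_ne_zero, neg_zero, zero_add,
    Finset.sum_eq_zero_iff_of_nonneg fun i _ => sq_nonneg _] at hv
  exact e.ext_elem fun i => by
    refine Fin.cases ?_ (fun j => ?_) i
    · simpa using hv0
    · simpa using hv j (Finset.mem_univ j)

theorem eq_smul_of_null (he : IsLorentzBasis B e) (hk0 : k ≠ 0) (hk : B k k = 0) (hv : B v v = 0)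
    (hkv : B k v = 0) (hvk : B v k = 0) : ∃ β : ℝ, v = β • k := by
  have hk00 : e.repr k 0 ≠ 0 := fun h => hk0 (he.eq_zero_of_null hk h)
  refine ⟨e.repr v 0 / e.repr k 0, sub_eq_zero.1 (he.eq_zero_of_null ?_ ?_)⟩
  · simp [hk, hv, hkv, hvk]
  · simp [hk00]

end IsLorentzBasis

end BilinForm

/-! ### Calculus and curvature in coordinates -/

theorem fderiv_clm_apply_apply {𝕜 E F₁ F₂ F₃ : Type*} [NontriviallyNormedField 𝕜]
    [NormedAddCommGroup E] [NormedSpace 𝕜 E] [NormedAddCommGroup F₁] [NormedSpace 𝕜 F₁]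
    [NormedAddCommGroup F₂] [NormedSpace 𝕜 F₂] [NormedAddCommGroup F₃] [NormedSpace 𝕜 F₃]
    {c : E → F₁ →L[𝕜] F₂ →L[𝕜] F₃} {X : E → F₁} {Y : E → F₂} {y : E}
    (hc : DifferentiableAt 𝕜 c y) (hX : DifferentiableAt 𝕜 X y) (hY : DifferentiableAt 𝕜 Y y)
    (u : E) :
    fderiv 𝕜 (fun z => c z (X z) (Y z)) y u =
      fderiv 𝕜 c y u (X y) (Y y) + c y (fderiv 𝕜 X y u) (Y y) + c y (X y) (fderiv 𝕜 Y y u) := by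
  rw [fderiv_clm_apply (hc.clm_apply hX) hY, fderiv_clm_apply hc hX]
  simp only [_root_.add_apply, ContinuousLinearMap.comp_apply, ContinuousLinearMap.flip_apply]
  abel

theorem fderiv_clm_apply_apply_const {𝕜 E F₁ F₂ F₃ : Type*} [NontriviallyNormedField 𝕜]
    [NormedAddCommGroup E] [NormedSpace 𝕜 E] [NormedAddCommGroup F₁] [NormedSpace 𝕜 F₁]
    [NormedAddCommGroup F₂] [NormedSpace 𝕜 F₂] [NormedAddCommGroup F₃] [NormedSpace 𝕜 F₃]
    {c : E → F₁ →L[𝕜] F₂ →L[𝕜] F₃} {y : E} (hc : DifferentiableAt 𝕜 c y) (u : E) (v : F₁)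
    (w : F₂) : fderiv 𝕜 (fun z => c z v w) y u = fderiv 𝕜 c y u v w := by
  simp [fderiv_clm_apply_apply hc (differentiableAt_const v) (differentiableAt_const w)]

theorem pair_symm_of_skew_of_bianchi {V : Type*} {R : V → V → V → V → ℝ}
    (skew_left : ∀ u v w z, R u v w z = -R v u w z)
    (skew_right : ∀ u v w z, R u v w z = -R u v z w)
    (bianchi : ∀ u v w z, R u v w z + R v w u z + R w u v z = 0) (u v w z : V) :
    R u v w z = R w z u v := by
  linarith [bianchi u v w z, bianchi v w z u, bianchi w z u v, bianchi z u v w,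
    skew_right u v w z, skew_left w u v z, skew_right w u z v, skew_right v w u z,
    skew_left z v w u, skew_right z v u w, skew_right w z v u, skew_left u w z v,
    skew_right z u v w, skew_left v z u w]

/-- `G` is a smooth pseudo-Riemannian metric on the open set `s` of the coordinate space. -/
structure IsMetricOn (G : E4 → E4 →L[ℝ] E4 →L[ℝ] ℝ) (s : Set E4) : Prop where
  isOpen : IsOpen s
  smooth : ContDiffOn ℝ ∞ G s
  symm : ∀ y ∈ s, ∀ v w, G y v w = G y w v
  invertible : ∀ y ∈ s, (G y).IsInvertible

/-- `christoffelLower` as a field of continuous bilinear maps, which makes its bilinearity and its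
smoothness available. -/
def christoffelLowerL (G : E4 → E4 →L[ℝ] E4 →L[ℝ] ℝ) (y : E4) : E4 →L[ℝ] E4 →L[ℝ] E4 →L[ℝ] ℝ :=
  (1 / 2 : ℝ) • (fderiv ℝ G y + (fderiv ℝ G y).flip -
    ((ContinuousLinearMap.flipₗᵢ ℝ E4 E4 ℝ).toContinuousLinearEquiv :
      (E4 →L[ℝ] E4 →L[ℝ] ℝ) →L[ℝ] (E4 →L[ℝ] E4 →L[ℝ] ℝ)).comp (fderiv ℝ G y).flip)

/-- `christoffel` as a field of continuous bilinear maps, which makes its bilinearity and its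
smoothness available. -/
def christoffelL (G : E4 → E4 →L[ℝ] E4 →L[ℝ] ℝ) (y : E4) : E4 →L[ℝ] E4 →L[ℝ] E4 :=
  (ContinuousLinearMap.compL ℝ E4 (E4 →L[ℝ] ℝ) E4 (G y).inverse).comp (christoffelLowerL G y)

theorem christoffelL_apply (G : E4 → E4 →L[ℝ] E4 →L[ℝ] ℝ) (y v w : E4) :
    christoffelL G y v w = christoffel G y v w := rfl

/-- The Levi-Civita covariant derivative `∇_u X` at `y` of a vector field `X` in coordinates. -/
def covDeriv (G : E4 → E4 →L[ℝ] E4 →L[ℝ] ℝ) (X : E4 → E4) (y u : E4) : E4 :=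
  fderiv ℝ X y u + christoffelL G y u (X y)

theorem riemann_eq_covDeriv_sub (G : E4 → E4 →L[ℝ] E4 →L[ℝ] ℝ) (y u v w : E4) :
    riemann G y u v w = covDeriv G (fun z => christoffelL G z v w) y u
      - covDeriv G (fun z => christoffelL G z u w) y v := by
  simp only [riemann, covDeriv, christoffelL_apply]
  abel

theorem riemann_skew_left (G : E4 → E4 →L[ℝ] E4 →L[ℝ] ℝ) (y u v w : E4) :
    riemann G y u v w = -riemann G y v u w := by
  simp only [riemann_eq_covDeriv_sub, neg_sub]

namespace IsMetricOn

variable {G : E4 → E4 →L[ℝ] E4 →L[ℝ] ℝ} {s : Set E4} {y : E4}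

theorem mem_nhds (hG : IsMetricOn G s) (hy : y ∈ s) : s ∈ 𝓝 y := hG.isOpen.mem_nhds hy

theorem contDiffAt (hG : IsMetricOn G s) (hy : y ∈ s) : ContDiffAt ℝ ∞ G y :=
  hG.smooth.contDiffAt (hG.mem_nhds hy)

theorem differentiableAt (hG : IsMetricOn G s) (hy : y ∈ s) : DifferentiableAt ℝ G y :=
  (hG.contDiffAt hy).differentiableAt (by simp)

theorem contDiffAt_inverse (hG : IsMetricOn G s) (hy : y ∈ s) :
    ContDiffAt ℝ ∞ (fun z => (G z).inverse) y :=
  (hG.invertible y hy).contDiffAt_map_inverse.comp y (hG.contDiffAt hy)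

theorem contDiffAt_christoffelL (hG : IsMetricOn G s) (hy : y ∈ s) :
    ContDiffAt ℝ ∞ (christoffelL G) y := by
  have hfderiv : ContDiffAt ℝ ∞ (fderiv ℝ G) y := (hG.contDiffAt hy).fderiv_right (by simp)
  have hflip : ContDiffAt ℝ ∞ (fun z => (fderiv ℝ G z).flip) y :=
    (ContinuousLinearMap.flipₗᵢ ℝ E4 E4 (E4 →L[ℝ] ℝ)).contDiff.contDiffAt.comp y hfderiv
  have hlower : ContDiffAt ℝ ∞ (christoffelLowerL G) y :=
    ((hfderiv.add hflip).sub (contDiffAt_const.clm_comp hflip)).const_smul _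
  exact ((ContinuousLinearMap.compL ℝ E4 (E4 →L[ℝ] ℝ) E4).contDiff.contDiffAt.comp y
    (hG.contDiffAt_inverse hy)).clm_comp hlower

theorem differentiableAt_christoffelL (hG : IsMetricOn G s) (hy : y ∈ s) :
    DifferentiableAt ℝ (christoffelL G) y :=
  (hG.contDiffAt_christoffelL hy).differentiableAt (by simp)

theorem covDeriv_christoffelL (hG : IsMetricOn G s) (hy : y ∈ s) (u v w : E4) :
    covDeriv G (fun z => christoffelL G z v w) y u =
      fderiv ℝ (christoffelL G) y u v w + christoffelL G y u (christoffelL G y v w) := by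
  rw [covDeriv, fderiv_clm_apply_apply_const (hG.differentiableAt_christoffelL hy)]

theorem apply_inverse (hG : IsMetricOn G s) (hy : y ∈ s) (l : E4 →L[ℝ] ℝ) :
    G y ((G y).inverse l) = l :=
  (((hG.invertible y hy).inverse_apply_eq).1 rfl).symm

theorem ext_apply (hG : IsMetricOn G s) (hy : y ∈ s) {v w : E4}
    (hvw : ∀ z, G y v z = G y w z) : v = w :=
  (hG.invertible y hy).injective (ContinuousLinearMap.ext hvw)

theorem apply_christoffelL (hG : IsMetricOn G s) (hy : y ∈ s) (v w z : E4) :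
    G y (christoffelL G y v w) z =
      1 / 2 * (fderiv ℝ G y v w z + fderiv ℝ G y w v z - fderiv ℝ G y z v w) := by
  rw [christoffelL_apply, christoffel, hG.apply_inverse hy]
  rfl

theorem fderiv_symm (hG : IsMetricOn G s) (hy : y ∈ s) (u v w : E4) :
    fderiv ℝ G y u v w = fderiv ℝ G y u w v := by
  have hsymm : (fun z => G z v w) =ᶠ[𝓝 y] fun z => G z w v := by
    filter_upwards [hG.mem_nhds hy] with z hz using hG.symm z hz v w
  rw [← fderiv_clm_apply_apply_const (hG.differentiableAt hy), hsymm.fderiv_eq,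
    fderiv_clm_apply_apply_const (hG.differentiableAt hy)]

theorem christoffelL_symm (hG : IsMetricOn G s) (hy : y ∈ s) (v w : E4) :
    christoffelL G y v w = christoffelL G y w v := by
  refine hG.ext_apply hy fun z => ?_
  rw [hG.apply_christoffelL hy, hG.apply_christoffelL hy, hG.fderiv_symm hy z v w]
  ring

theorem fderiv_eq_christoffelL (hG : IsMetricOn G s) (hy : y ∈ s) (u v w : E4) :
    fderiv ℝ G y u v w = G y (christoffelL G y u v) w + G y v (christoffelL G y u w) := by
  rw [hG.symm y hy v, hG.apply_christoffelL hy, hG.apply_christoffelL hy,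
    hG.fderiv_symm hy w u v, hG.fderiv_symm hy v u w, hG.fderiv_symm hy u w v]
  ring

theorem fderiv_apply_apply_eq_covDeriv (hG : IsMetricOn G s) (hy : y ∈ s) {X Y : E4 → E4}
    (hX : DifferentiableAt ℝ X y) (hY : DifferentiableAt ℝ Y y) (u : E4) :
    fderiv ℝ (fun z => G z (X z) (Y z)) y u =
      G y (covDeriv G X y u) (Y y) + G y (X y) (covDeriv G Y y u) := by
  rw [fderiv_clm_apply_apply (hG.differentiableAt hy) hX hY, hG.fderiv_eq_christoffelL hy]
  simp only [covDeriv, map_add, _root_.add_apply]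
  ring

theorem fderiv_fderiv_apply_apply (hG : IsMetricOn G s) (hy : y ∈ s) (u v w z : E4) :
    fderiv ℝ (fderiv ℝ (fun x => G x w z)) y u v =
      G y (covDeriv G (fun x => christoffelL G x v w) y u) z
        + G y (christoffelL G y v w) (christoffelL G y u z)
        + G y (christoffelL G y u w) (christoffelL G y v z)
        + G y w (covDeriv G (fun x => christoffelL G x v z) y u) := by
  have hΓ := hG.differentiableAt_christoffelL hy
  have hGd := hG.differentiableAt hy
  have hf : ContDiffAt ℝ ∞ (fun x => G x w z) y :=
    ((hG.contDiffAt hy).clm_apply contDiffAt_const).clm_apply contDiffAt_const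
  have hf' : DifferentiableAt ℝ (fderiv ℝ fun x => G x w z) y :=
    (hf.fderiv_right (m := ∞) (by simp)).differentiableAt (by simp)
  have first : (fun x => fderiv ℝ (fun x => G x w z) x v) =ᶠ[𝓝 y] fun x =>
      G x (christoffelL G x v w) z + G x w (christoffelL G x v z) := by
    filter_upwards [hG.mem_nhds hy] with x hx
    rw [fderiv_clm_apply_apply_const (hG.differentiableAt hx), hG.fderiv_eq_christoffelL hx]
  have hconst : fderiv ℝ (fun x => fderiv ℝ (fun x => G x w z) x v) y u =
      fderiv ℝ (fderiv ℝ fun x => G x w z) y u v := by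
    simp [fderiv_clm_apply hf' (differentiableAt_const v)]
  rw [← hconst, first.fderiv_eq, fderiv_fun_add (by fun_prop) (by fun_prop), _root_.add_apply,
    hG.fderiv_apply_apply_eq_covDeriv hy (X := fun x => christoffelL G x v w) (by fun_prop)
      (differentiableAt_const z),
    hG.fderiv_apply_apply_eq_covDeriv hy (Y := fun x => christoffelL G x v z)
      (differentiableAt_const w) (by fun_prop)]
  simp only [covDeriv, fderiv_fun_const, Pi.zero_apply, _root_.zero_apply, zero_add]
  ring

theorem riemann_skew_right (hG : IsMetricOn G s) (hy : y ∈ s) (u v w z : E4) :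
    G y (riemann G y u v w) z = -G y (riemann G y u v z) w := by
  have hf : ContDiffAt ℝ ∞ (fun x => G x w z) y :=
    ((hG.contDiffAt hy).clm_apply contDiffAt_const).clm_apply contDiffAt_const
  have hle : minSmoothness ℝ 2 ≤ ∞ := by
    rw [minSmoothness_of_isRCLikeNormedField]
    exact WithTop.coe_le_coe.2 (le_top : (2 : ℕ∞) ≤ ⊤)
  have hsymm := (hf.isSymmSndFDerivAt hle).eq u v
  rw [hG.fderiv_fderiv_apply_apply hy, hG.fderiv_fderiv_apply_apply hy] at hsymm
  rw [hG.symm y hy (riemann G y u v z)]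
  simp only [riemann_eq_covDeriv_sub, map_sub, _root_.sub_apply]
  linarith

theorem riemann_bianchi (hG : IsMetricOn G s) (hy : y ∈ s) (u v w : E4) :
    riemann G y u v w + riemann G y v w u + riemann G y w u v = 0 := by
  have hsymm : ∀ a v w, covDeriv G (fun z => christoffelL G z v w) y a =
      covDeriv G (fun z => christoffelL G z w v) y a := fun a v w => by
    have : (fun z => christoffelL G z v w) =ᶠ[𝓝 y] fun z => christoffelL G z w v := by
      filter_upwards [hG.mem_nhds hy] with z hz using hG.christoffelL_symm hz v w
    simp only [covDeriv, this.fderiv_eq, this.self_of_nhds]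
  simp only [riemann_eq_covDeriv_sub]
  rw [hsymm u w v, hsymm v u w, hsymm w v u]
  abel

theorem riemann_pair_symm (hG : IsMetricOn G s) (hy : y ∈ s) (u v w z : E4) :
    G y (riemann G y u v w) z = G y (riemann G y w z u) v := by
  refine pair_symm_of_skew_of_bianchi (R := fun u v w z => G y (riemann G y u v w) z)
    (fun u v w z => ?_) (hG.riemann_skew_right hy) (fun u v w z => ?_) u v w z
  · rw [riemann_skew_left, map_neg, _root_.neg_apply]
  · rw [← _root_.add_apply, ← _root_.add_apply, ← map_add, ← map_add, hG.riemann_bianchi hy,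
      map_zero, _root_.zero_apply]

end IsMetricOn

/-! ### Conformally flat metrics in null directions -/

section Conformal

variable {F : E4 → ℝ} {G H : E4 → E4 →L[ℝ] E4 →L[ℝ] ℝ} {s : Set E4} {y : E4}

/-- The logarithmic differential `dF / F`; it governs how the Christoffel symbols change when a
metric is multiplied by `F ^ 2`. -/
def logDiff (F : E4 → ℝ) (y : E4) : E4 →L[ℝ] ℝ := (F y)⁻¹ • fderiv ℝ F y

theorem fderiv_eq_smul_logDiff (hF0 : F y ≠ 0) : fderiv ℝ F y = F y • logDiff F y := by
  rw [logDiff, smul_smul, mul_inv_cancel₀ hF0, one_smul]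

theorem differentiableAt_logDiff (hF : ContDiffAt ℝ 2 F y) (hF0 : F y ≠ 0) :
    DifferentiableAt ℝ (logDiff F) y :=
  ((hF.differentiableAt (by simp)).inv hF0).smul
    ((hF.fderiv_right (m := 1) (by norm_num)).differentiableAt (by simp))

theorem fderiv_fderiv_eq_logDiff (hF : ContDiffAt ℝ 2 F y) (hF0 : F y ≠ 0) (u v : E4) :
    fderiv ℝ (fderiv ℝ F) y u v =
      F y * (fderiv ℝ (logDiff F) y u v + logDiff F y u * logDiff F y v) := by
  have hF' : DifferentiableAt ℝ F y := hF.differentiableAt (by simp)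
  have hne : ∀ᶠ z in 𝓝 y, F z ≠ 0 := hF'.continuousAt.eventually_ne hF0
  have hmul : fderiv ℝ F =ᶠ[𝓝 y] fun z => F z • logDiff F z :=
    hne.mono fun z hz => fderiv_eq_smul_logDiff hz
  rw [hmul.fderiv_eq, fderiv_fun_smul hF' (differentiableAt_logDiff hF hF0),
    fderiv_eq_smul_logDiff hF0]
  simp only [_root_.add_apply, _root_.smul_apply, ContinuousLinearMap.smulRight_apply, smul_eq_mul]
  ring

theorem fderiv_sq_smul (hF : DifferentiableAt ℝ F y) (hF0 : F y ≠ 0) (hH : DifferentiableAt ℝ H y)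
    (u v w : E4) :
    fderiv ℝ (fun z => F z ^ 2 • H z) y u v w =
      F y ^ 2 * (2 * logDiff F y u * H y v w + fderiv ℝ H y u v w) := by
  rw [fderiv_fun_smul (by fun_prop) hH, fderiv_fun_pow 2 hF, fderiv_eq_smul_logDiff hF0]
  simp
  ring

theorem christoffelL_conformal (hG : IsMetricOn G s) (hH : IsMetricOn H s)
    (hF : ContDiffOn ℝ 2 F s) (hF0 : ∀ z ∈ s, F z ≠ 0) (hGH : ∀ z ∈ s, G z = F z ^ 2 • H z)
    (hy : y ∈ s) (v w : E4) :
    christoffelL G y v w = christoffelL H y v w + logDiff F y v • w + logDiff F y w • v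
      - H y v w • (H y).inverse (logDiff F y) := by
  have hF' : DifferentiableAt ℝ F y :=
    (hF.contDiffAt (hG.mem_nhds hy)).differentiableAt (by simp)
  have hGH' : G =ᶠ[𝓝 y] fun z => F z ^ 2 • H z := by filter_upwards [hG.mem_nhds hy] using hGH
  refine hG.ext_apply hy fun z => ?_
  rw [hG.apply_christoffelL hy, hGH'.fderiv_eq]
  simp only [fderiv_sq_smul hF' (hF0 y hy) (hH.differentiableAt hy), hGH y hy, map_add, map_sub,
    map_smul, _root_.add_apply, _root_.sub_apply, _root_.smul_apply, hH.apply_inverse hy,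
    hH.apply_christoffelL hy, smul_eq_mul]
  ring

theorem fderiv_christoffelL_conformal (hG : IsMetricOn G s) (hH : IsMetricOn H s)
    (hF : ContDiffOn ℝ 2 F s) (hF0 : ∀ z ∈ s, F z ≠ 0) (hGH : ∀ z ∈ s, G z = F z ^ 2 • H z)
    (hy : y ∈ s) (u v w : E4) :
    fderiv ℝ (christoffelL G) y u v w =
      fderiv ℝ (christoffelL H) y u v w + fderiv ℝ (logDiff F) y u v • w
        + fderiv ℝ (logDiff F) y u w • v - fderiv ℝ H y u v w • (H y).inverse (logDiff F y)
        - H y v w • fderiv ℝ (fun z => (H z).inverse (logDiff F z)) y u := by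
  have hΓG := hG.differentiableAt_christoffelL hy
  have hΓH := hH.differentiableAt_christoffelL hy
  have hH' := hH.differentiableAt hy
  have hα : DifferentiableAt ℝ (logDiff F) y :=
    differentiableAt_logDiff (hF.contDiffAt (hG.mem_nhds hy)) (hF0 y hy)
  have hA : DifferentiableAt ℝ (fun z => (H z).inverse (logDiff F z)) y :=
    ((hH.contDiffAt_inverse hy).differentiableAt (by simp)).clm_apply hα
  have hαv : ∀ v, fderiv ℝ (fun z => logDiff F z v) y u = fderiv ℝ (logDiff F) y u v := fun v => by
    simp [fderiv_clm_apply hα (differentiableAt_const v)]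
  have hΓ : (fun z => christoffelL G z v w) =ᶠ[𝓝 y] fun z =>
      christoffelL H z v w + logDiff F z v • w + logDiff F z w • v
        - H z v w • (H z).inverse (logDiff F z) := by
    filter_upwards [hG.mem_nhds hy] with z hz using christoffelL_conformal hG hH hF hF0 hGH hz v w
  have hHA : DifferentiableAt ℝ (fun z => H z v w • (H z).inverse (logDiff F z)) y :=
    ((hH'.clm_apply (differentiableAt_const v)).clm_apply (differentiableAt_const w)).smul hA
  rw [← fderiv_clm_apply_apply_const hΓG, hΓ.fderiv_eq, fderiv_fun_sub (by fun_prop) hHA,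
    fderiv_fun_add (by fun_prop) (by fun_prop), fderiv_fun_add (by fun_prop) (by fun_prop),
    fderiv_fun_smul (by fun_prop) hA, fderiv_smul_const (by fun_prop),
    fderiv_smul_const (by fun_prop)]
  simp only [_root_.add_apply, _root_.sub_apply, _root_.smul_apply,
    ContinuousLinearMap.smulRight_apply, fderiv_clm_apply_apply_const hΓH,
    fderiv_clm_apply_apply_const hH', hαv]
  abel

theorem riemann_conformal_null (hG : IsMetricOn G s) (hH : IsMetricOn H s)
    (hF : ContDiffOn ℝ 2 F s) (hF0 : ∀ z ∈ s, F z ≠ 0) (hGH : ∀ z ∈ s, G z = F z ^ 2 • H z)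
    (hy : y ∈ s) (hflat : ∀ u v w, riemann H y u v w = 0) {k v : E4} (hk : H y k k = 0)
    (hv : H y v k = 0) :
    ∃ β : ℝ, F y • riemann G y v k k =
      β • k - (fderiv ℝ (fderiv ℝ F) y k k - fderiv ℝ F y (christoffelL G y k k)) • v := by
  have hkv : H y k v = 0 := by rw [hH.symm y hy, hv]
  have hΓflat : fderiv ℝ (christoffelL H) y v k k =
      fderiv ℝ (christoffelL H) y k v k + christoffelL H y k (christoffelL H y v k)
        - christoffelL H y v (christoffelL H y k k) := by
    have := hflat v k k
    rw [riemann_eq_covDeriv_sub, hH.covDeriv_christoffelL hy, hH.covDeriv_christoffelL hy,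
      sub_eq_zero] at this
    rw [← this, add_sub_cancel_right]
  refine ⟨F y * (2 * fderiv ℝ (logDiff F) y v k - fderiv ℝ (logDiff F) y k v
    - logDiff F y k * logDiff F y v - logDiff F y (christoffelL H y v k)), ?_⟩
  rw [fderiv_fderiv_eq_logDiff (hF.contDiffAt (hG.mem_nhds hy)) (hF0 y hy),
    fderiv_eq_smul_logDiff (hF0 y hy), riemann_eq_covDeriv_sub, hG.covDeriv_christoffelL hy,
    hG.covDeriv_christoffelL hy]
  simp only [fderiv_christoffelL_conformal hG hH hF hF0 hGH hy,
    christoffelL_conformal hG hH hF hF0 hGH hy, hΓflat, hH.fderiv_eq_christoffelL hy, hk, hv, hkv,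
    zero_smul, map_add, map_smul, sub_zero, add_zero, _root_.smul_apply, smul_eq_mul,
    mul_zero]
  rw [hH.christoffelL_symm hy k v, hH.symm y hy (christoffelL H y v k) k]
  module

end Conformal

/-! ### Tensor fields in charts -/

theorem mem_target_inter_preimage_symm {X Y : Type*} [TopologicalSpace X] [TopologicalSpace Y]
    {φ : OpenPartialHomeomorph X Y} {U : Set X} {x : X} (hx : x ∈ φ.source) (hxU : x ∈ U) :
    φ x ∈ φ.target ∩ φ.symm ⁻¹' U :=
  ⟨φ.map_source hx, by rwa [mem_preimage, φ.left_inv hx]⟩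

section Chart

variable {M : Type*} [TopologicalSpace M] [ChartedSpace E4 M]
  {φ : OpenPartialHomeomorph M E4} {h η : FormField M} {U V : Set M} {x : M}

theorem toChart_zero (φ : OpenPartialHomeomorph M E4) (x : M) : toChart φ x 0 = 0 :=
  map_zero (mfderiv 𝓘(ℝ, E4) 𝓘(ℝ, E4) φ x)

theorem toChart_add (φ : OpenPartialHomeomorph M E4) (x : M) (v w : TangentSpace 𝓘(ℝ, E4) x) :
    toChart φ x (v + w) = toChart φ x v + toChart φ x w :=
  map_add (mfderiv 𝓘(ℝ, E4) 𝓘(ℝ, E4) φ x) v w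

theorem toChart_sub (φ : OpenPartialHomeomorph M E4) (x : M) (v w : TangentSpace 𝓘(ℝ, E4) x) :
    toChart φ x (v - w) = toChart φ x v - toChart φ x w :=
  map_sub (mfderiv 𝓘(ℝ, E4) 𝓘(ℝ, E4) φ x) v w

theorem toChart_smul (φ : OpenPartialHomeomorph M E4) (x : M) (c : ℝ)
    (v : TangentSpace 𝓘(ℝ, E4) x) : toChart φ x (c • v) = c • toChart φ x v :=
  map_smul (mfderiv 𝓘(ℝ, E4) 𝓘(ℝ, E4) φ x) c v

theorem IsLorentzianOn.mono (hL : IsLorentzianOn h V) (hUV : U ⊆ V) : IsLorentzianOn h U where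
  smooth φ hφ := (hL.smooth φ hφ).mono (inter_subset_inter_right _ (preimage_mono hUV))
  symm x hx := hL.symm x (hUV hx)
  signature x hx := hL.signature x (hUV hx)

theorem IsLorentzianOn.exists_isLorentzBasis (hL : IsLorentzianOn h U) (hx : x ∈ U) :
    ∃ e : Module.Basis (Fin 4) ℝ (TangentSpace 𝓘(ℝ, E4) x),
      IsLorentzBasis (h x).toBilinForm e :=
  hL.signature x hx

theorem IsLorentzianOn.separatingLeft (hL : IsLorentzianOn h U) (hx : x ∈ U) :
    (h x).toBilinForm.SeparatingLeft :=
  let ⟨_, he⟩ := hL.exists_isLorentzBasis hx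
  he.separatingLeft

variable [IsManifold 𝓘(ℝ, E4) ∞ M]

theorem toChart_symm_apply (hφ : φ ∈ atlas E4 M) (hx : x ∈ φ.source)
    (v : TangentSpace 𝓘(ℝ, E4) x) :
    (mfderiv 𝓘(ℝ, E4) 𝓘(ℝ, E4) φ.symm (φ x) (toChart φ x v) : E4) = v :=
  congrArg (fun L : E4 →L[ℝ] E4 => L v)
    ((mdifferentiable_of_mem_atlas (I := 𝓘(ℝ, E4)) hφ).symm_comp_deriv hx)

theorem toChart_injective (hφ : φ ∈ atlas E4 M) (hx : x ∈ φ.source) :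
    Function.Injective (toChart φ x) :=
  (mdifferentiable_of_mem_atlas (I := 𝓘(ℝ, E4)) hφ).mfderiv_injective hx

theorem toChart_surjective (hφ : φ ∈ atlas E4 M) (hx : x ∈ φ.source) :
    Function.Surjective (toChart φ x) :=
  (mdifferentiable_of_mem_atlas (I := 𝓘(ℝ, E4)) hφ).mfderiv_surjective hx

theorem toChart_eq_zero_iff (hφ : φ ∈ atlas E4 M) (hx : x ∈ φ.source)
    {v : TangentSpace 𝓘(ℝ, E4) x} : toChart φ x v = 0 ↔ v = 0 := by
  rw [← toChart_zero φ x, (toChart_injective hφ hx).eq_iff]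

theorem coordForm_toChart (h : FormField M) (hφ : φ ∈ atlas E4 M) (hx : x ∈ φ.source)
    (v w : TangentSpace 𝓘(ℝ, E4) x) :
    coordForm h φ (φ x) (toChart φ x v) (toChart φ x w) = h x v w := by
  have transport : ∀ x', x' = x → ∀ a b : E4,
      (h x' : E4 →L[ℝ] E4 →L[ℝ] ℝ) a b = (h x : E4 →L[ℝ] E4 →L[ℝ] ℝ) a b := by
    rintro _ rfl a b
    rfl
  have at_x := transport _ (φ.left_inv hx) (mfderiv 𝓘(ℝ, E4) 𝓘(ℝ, E4) φ.symm (φ x) (toChart φ x v))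
    (mfderiv 𝓘(ℝ, E4) 𝓘(ℝ, E4) φ.symm (φ x) (toChart φ x w))
  refine Eq.trans at_x ?_
  rw [toChart_symm_apply hφ hx, toChart_symm_apply hφ hx]

theorem IsLorentzianOn.isMetricOn (hL : IsLorentzianOn h U) (hU : IsOpen U)
    (hφ : φ ∈ atlas E4 M) : IsMetricOn (coordForm h φ) (φ.target ∩ φ.symm ⁻¹' U) where
  isOpen := φ.symm.isOpen_inter_preimage hU
  smooth := hL.smooth φ hφ
  symm y hy v w := hL.symm _ hy.2 _ _
  invertible y hy := by
    obtain ⟨x, hx, rfl⟩ : ∃ x ∈ φ.source, φ x = y :=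
      ⟨φ.symm y, φ.map_target hy.1, φ.right_inv hy.1⟩
    have hxU : x ∈ U := by simpa only [mem_preimage, φ.left_inv hx] using hy.2
    refine isInvertible_of_separating fun a ha => ?_
    obtain ⟨v, rfl⟩ := toChart_surjective hφ hx a
    rw [toChart_eq_zero_iff hφ hx]
    exact hL.separatingLeft hxU v fun w =>
      (coordForm_toChart h hφ hx v w).symm.trans (ha _)

end Chart

/-! ### Covariant derivatives along a curve -/

section Along

variable {M : Type*} [TopologicalSpace M] [ChartedSpace E4 M]
  {φ : OpenPartialHomeomorph M E4} {h : FormField M} {γ : ℝ → M} {I : Set ℝ} {t : ℝ}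
  {V W : ∀ s, TangentSpace 𝓘(ℝ, E4) (γ s)} {V' W' : TangentSpace 𝓘(ℝ, E4) (γ t)}

/-- The vector `V'` at `γ t` is the Levi-Civita covariant derivative at `t` of the vector field `V`
along `γ`. This is `IsCovariantDerivAlong` at a single parameter. -/
def HasCovDerivWithinAt (h : FormField M) (γ : ℝ → M) (I : Set ℝ)
    (V : ∀ s, TangentSpace 𝓘(ℝ, E4) (γ s)) (t : ℝ) (V' : TangentSpace 𝓘(ℝ, E4) (γ t)) : Prop :=
  ∀ φ ∈ atlas E4 M, γ t ∈ φ.source →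
    HasDerivWithinAt (fun s => toChart φ (γ s) (V s))
      (toChart φ (γ t) V' - christoffelL (coordForm h φ) (φ (γ t))
        (toChart φ (γ t) (velocity γ I t)) (toChart φ (γ t) (V t))) I t

theorem isCovariantDerivAlong_iff {V' : ∀ s, TangentSpace 𝓘(ℝ, E4) (γ s)} :
    IsCovariantDerivAlong h γ I V V' ↔ ∀ t ∈ I, HasCovDerivWithinAt h γ I V t (V' t) :=
  ⟨fun hV t ht φ hφ hx => hV φ hφ t ht hx, fun hV φ hφ t ht hx => hV t ht φ hφ hx⟩

theorem HasCovDerivWithinAt.sub (hV : HasCovDerivWithinAt h γ I V t V')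
    (hW : HasCovDerivWithinAt h γ I W t W') :
    HasCovDerivWithinAt h γ I (fun s => V s - W s) t (V' - W') := fun φ hφ hx => by
  simp only [toChart_sub]
  refine ((hV φ hφ hx).sub (hW φ hφ hx)).congr_deriv ?_
  rw [map_sub]
  abel

theorem HasCovDerivWithinAt.smul {c : ℝ → ℝ} {c' : ℝ} (hc : HasDerivWithinAt c c' I t)
    (hV : HasCovDerivWithinAt h γ I V t V') :
    HasCovDerivWithinAt h γ I (fun s => c s • V s) t (c t • V' + c' • V t) := fun φ hφ hx => by
  simp only [toChart_smul]
  refine (hc.smul (hV φ hφ hx)).congr_deriv ?_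
  rw [toChart_add, toChart_smul, toChart_smul, map_smul]
  module

theorem IsGeodesicOn.hasCovDerivWithinAt_velocity (hγ : IsGeodesicOn h γ I) (ht : t ∈ I) :
    HasCovDerivWithinAt h γ I (velocity γ I) t 0 :=
  isCovariantDerivAlong_iff.1 hγ.2 t ht

variable [IsManifold 𝓘(ℝ, E4) ∞ M]

theorem hasDerivWithinAt_chart (hγ : MDifferentiableWithinAt 𝓘(ℝ, ℝ) 𝓘(ℝ, E4) γ I t)
    (hφ : φ ∈ atlas E4 M) (hx : γ t ∈ φ.source) :
    HasDerivWithinAt (fun s => φ (γ s)) (toChart φ (γ t) (velocity γ I t)) I t := by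
  let A : ℝ →L[ℝ] E4 := (mfderiv 𝓘(ℝ, E4) 𝓘(ℝ, E4) φ (γ t)).comp
    (mfderivWithin 𝓘(ℝ, ℝ) 𝓘(ℝ, E4) γ I t)
  have hA : HasFDerivWithinAt (fun s => φ (γ s)) A I t :=
    ((mdifferentiableAt_atlas (I := 𝓘(ℝ, E4)) hφ hx).hasMFDerivAt.comp_hasMFDerivWithinAt t
      hγ.hasMFDerivWithinAt).hasFDerivWithinAt
  exact (hA.hasDerivWithinAt : HasDerivWithinAt _ (A 1) I t)

theorem HasCovDerivWithinAt.hasDerivWithinAt_metric (hL : IsLorentzianOn h univ)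
    (hγ : MDifferentiableWithinAt 𝓘(ℝ, ℝ) 𝓘(ℝ, E4) γ I t)
    (hV : HasCovDerivWithinAt h γ I V t V') (hW : HasCovDerivWithinAt h γ I W t W') :
    HasDerivWithinAt (fun s => h (γ s) (V s) (W s))
      (h (γ t) V' (W t) + h (γ t) (V t) W') I t := by
  obtain ⟨φ, hφ, hx⟩ : ∃ φ ∈ atlas E4 M, γ t ∈ φ.source :=
    ⟨_, chart_mem_atlas E4 (γ t), mem_chart_source E4 (γ t)⟩
  have hG := hL.isMetricOn isOpen_univ hφ
  have hy := mem_target_inter_preimage_symm hx (mem_univ _)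
  have hcomp := (hG.differentiableAt hy).hasFDerivAt.comp_hasDerivWithinAt t
    (hasDerivWithinAt_chart hγ hφ hx)
  have hcoord := (hcomp.clm_apply (hV φ hφ hx)).clm_apply (hW φ hφ hx)
  refine (hcoord.congr_of_eventuallyEq ?_ (coordForm_toChart h hφ hx _ _).symm).congr_deriv ?_
  · filter_upwards [hγ.continuousWithinAt (φ.open_source.mem_nhds hx)] with s hs
    exact (coordForm_toChart h hφ hs _ _).symm
  · rw [← coordForm_toChart h hφ hx, ← coordForm_toChart h hφ hx]
    simp only [Function.comp_apply, _root_.add_apply, map_sub, _root_.sub_apply,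
      hG.fderiv_eq_christoffelL hy]
    ring

end Along

/-! ### The tidal form -/

/-- The tidal endomorphism `v ↦ R(v, k) k` of the metric `G`, written in terms of `christoffelL` so
that its linearity in `v` and its continuity in `y` and `k` become available. -/
def tidalL (G : E4 → E4 →L[ℝ] E4 →L[ℝ] ℝ) (y k : E4) : E4 →L[ℝ] E4 :=
  ((fderiv ℝ (christoffelL G) y).flip k).flip k - (fderiv ℝ (christoffelL G) y k).flip k +
    (christoffelL G y).flip (christoffelL G y k k) -
    (christoffelL G y k).comp ((christoffelL G y).flip k)

theorem IsMetricOn.tidalL_apply {G : E4 → E4 →L[ℝ] E4 →L[ℝ] ℝ} {s : Set E4} {y : E4}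
    (hG : IsMetricOn G s) (hy : y ∈ s) (k v : E4) : tidalL G y k v = riemann G y v k k := by
  rw [riemann_eq_covDeriv_sub, hG.covDeriv_christoffelL hy, hG.covDeriv_christoffelL hy]
  simp only [tidalL, _root_.sub_apply, _root_.add_apply, ContinuousLinearMap.flip_apply,
    ContinuousLinearMap.comp_apply]
  abel

theorem IsMetricOn.tidalL_self {G : E4 → E4 →L[ℝ] E4 →L[ℝ] ℝ} {s : Set E4} {y : E4}
    (hG : IsMetricOn G s) (hy : y ∈ s) (k : E4) : tidalL G y k k = 0 := by
  rw [hG.tidalL_apply hy, riemann_eq_covDeriv_sub, sub_self]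

section TidalForm

variable {M : Type*} [TopologicalSpace M] [ChartedSpace E4 M] {h η : FormField M} {U : Set M}
  {x : M} {k v z : TangentSpace 𝓘(ℝ, E4) x}

/-- The tidal form `⟨R(v, k) k, z⟩` of the metric `h` at `x`, evaluated in the preferred chart at
`x`. -/
def tidalForm (h : FormField M) (x : M) (k v z : TangentSpace 𝓘(ℝ, E4) x) : ℝ :=
  coordForm h (chartAt E4 x) (chartAt E4 x x)
    (riemann (coordForm h (chartAt E4 x)) (chartAt E4 x x) (toChart (chartAt E4 x) x v)
      (toChart (chartAt E4 x) x k) (toChart (chartAt E4 x) x k))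
    (toChart (chartAt E4 x) x z)

/-- The Hessian `(∇ df)(v, z)` of the function `f` at `x`, for the metric `h`, evaluated in the
preferred chart at `x`. -/
def hessian (h : FormField M) (f : M → ℝ) (x : M) (v z : TangentSpace 𝓘(ℝ, E4) x) : ℝ :=
  fderiv ℝ (fderiv ℝ (f ∘ (chartAt E4 x).symm)) (chartAt E4 x x) (toChart (chartAt E4 x) x v)
      (toChart (chartAt E4 x) x z) -
    fderiv ℝ (f ∘ (chartAt E4 x).symm) (chartAt E4 x x)
      (christoffelL (coordForm h (chartAt E4 x)) (chartAt E4 x x) (toChart (chartAt E4 x) x v)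
        (toChart (chartAt E4 x) x z))

theorem coordForm_conformal {Ω : M → ℝ} {φ : OpenPartialHomeomorph M E4}
    (hc : ∀ x ∈ U, h x = Ω x ^ 2 • η x) {y : E4} (hy : φ.symm y ∈ U) :
    coordForm h φ y = (Ω ∘ φ.symm) y ^ 2 • coordForm η φ y := by
  rw [coordForm, coordForm, hc _ hy]
  rfl

variable [IsManifold 𝓘(ℝ, E4) ∞ M]

theorem IsLorentzianOn.tidalForm_comm (hL : IsLorentzianOn h U) (hU : IsOpen U) (hx : x ∈ U) :
    tidalForm h x k v z = tidalForm h x k z v := by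
  have hG := hL.isMetricOn hU (chart_mem_atlas E4 x)
  have hy := mem_target_inter_preimage_symm (mem_chart_source E4 x) hx
  rw [tidalForm, hG.riemann_pair_symm hy, hG.riemann_skew_right hy, riemann_skew_left, map_neg,
    _root_.neg_apply, neg_neg, tidalForm]

theorem IsLorentzianOn.tidalForm_self_right (hL : IsLorentzianOn h U) (hU : IsOpen U)
    (hx : x ∈ U) : tidalForm h x k v k = 0 := by
  have hG := hL.isMetricOn hU (chart_mem_atlas E4 x)
  have hy := mem_target_inter_preimage_symm (mem_chart_source E4 x) hx
  exact self_eq_neg.1 (hG.riemann_skew_right hy _ _ _ _)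

theorem contDiffOn_comp_chartAt_symm {f : M → ℝ} (hf : ContMDiffOn 𝓘(ℝ, E4) 𝓘(ℝ, ℝ) ∞ f U)
    (x : M) : ContDiffOn ℝ ∞ (f ∘ (chartAt E4 x).symm)
      ((chartAt E4 x).target ∩ (chartAt E4 x).symm ⁻¹' U) :=
  (hf.comp ((contMDiffOn_chart_symm (I := 𝓘(ℝ, E4))).mono inter_subset_left)
    inter_subset_right).contDiffOn

theorem mul_tidalForm_of_conformallyFlat {Ω : M → ℝ} (hU : IsOpen U) (hL : IsLorentzianOn h U)
    (hΩ : ContMDiffOn 𝓘(ℝ, E4) 𝓘(ℝ, ℝ) ∞ Ω U) (hΩ0 : ∀ x ∈ U, 0 < Ω x)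
    (hη : IsLorentzianOn η U) (hflat : IsFlatOn η U) (hc : ∀ x ∈ U, h x = Ω x ^ 2 • η x)
    (hx : x ∈ U) (hk : h x k k = 0) (hvk : h x v k = 0) (hkz : h x k z = 0) :
    Ω x * tidalForm h x k v z = -(hessian h Ω x k k * h x v z) := by
  have hφ := chart_mem_atlas E4 x
  have hxs := mem_chart_source E4 x
  have hnull : ∀ {v w}, h x v w = 0 → coordForm η (chartAt E4 x) (chartAt E4 x x)
      (toChart (chartAt E4 x) x v) (toChart (chartAt E4 x) x w) = 0 := fun {v w} hvw => by
    rw [hc x hx] at hvw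
    rw [coordForm_toChart η hφ hxs]
    exact (mul_eq_zero.1 hvw).resolve_left (pow_ne_zero 2 (hΩ0 x hx).ne')
  obtain ⟨β, hβ⟩ := riemann_conformal_null (hL.isMetricOn hU hφ) (hη.isMetricOn hU hφ)
    ((contDiffOn_comp_chartAt_symm hΩ x).of_le (by norm_cast))
    (fun y hy => (hΩ0 _ hy.2).ne') (fun y hy => coordForm_conformal hc hy.2)
    (mem_target_inter_preimage_symm hxs hx) (hflat _ hφ x ⟨hx, hxs⟩) (hnull hk) (hnull hvk)
  have hpair := congrArg (fun a => coordForm h (chartAt E4 x) (chartAt E4 x x) a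
    (toChart (chartAt E4 x) x z)) hβ
  simp only [map_smul, map_sub, _root_.smul_apply, _root_.sub_apply, smul_eq_mul,
    coordForm_toChart h hφ hxs, hkz, Function.comp_apply, (chartAt E4 x).left_inv hxs] at hpair
  rw [tidalForm, hessian, hpair]
  ring

end TidalForm

/-! ### Jacobi fields -/

section Jacobi

variable {M : Type*} [TopologicalSpace M] [ChartedSpace E4 M] {h : FormField M} {γ : ℝ → M}
  {I : Set ℝ} {a b t : ℝ} {J DJ DDJ K DK DDK : ∀ s, TangentSpace 𝓘(ℝ, E4) (γ s)}

/-- The first order system `(J, DJ)' = jacobiOperator (J, DJ)` equivalent to the geodesic deviation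
equation, in coordinates and along a curve with velocity `k`. -/
def jacobiOperator (G : E4 → E4 →L[ℝ] E4 →L[ℝ] ℝ) (y k : E4) : E4 × E4 →L[ℝ] E4 × E4 :=
  (ContinuousLinearMap.snd ℝ E4 E4 -
      (christoffelL G y k).comp (ContinuousLinearMap.fst ℝ E4 E4)).prod
    (-(tidalL G y k).comp (ContinuousLinearMap.fst ℝ E4 E4) -
      (christoffelL G y k).comp (ContinuousLinearMap.snd ℝ E4 E4))

theorem IsMetricOn.continuousWithinAt_jacobiOperator {G : E4 → E4 →L[ℝ] E4 →L[ℝ] ℝ} {s : Set E4}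
    {c k : ℝ → E4} (hG : IsMetricOn G s) (hct : c t ∈ s) (hc : ContinuousWithinAt c I t)
    (hk : ContinuousWithinAt k I t) :
    ContinuousWithinAt (fun r => jacobiOperator G (c r) (k r)) I t := by
  have hΓ : ContinuousWithinAt (fun r => christoffelL G (c r)) I t :=
    (hG.contDiffAt_christoffelL hct).continuousAt.comp_continuousWithinAt hc
  have hDΓ : ContinuousWithinAt (fun r => fderiv ℝ (christoffelL G) (c r)) I t :=
    ((hG.contDiffAt_christoffelL hct).fderiv_right (m := 0) (by simp)).continuousAt
      |>.comp_continuousWithinAt hc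
  refine continuousWithinAt_clm_apply.2 fun p => ?_
  simp only [jacobiOperator, tidalL, ContinuousLinearMap.prod_apply, _root_.sub_apply,
    _root_.add_apply, _root_.neg_apply, ContinuousLinearMap.comp_apply,
    ContinuousLinearMap.flip_apply, ContinuousLinearMap.coe_fst', ContinuousLinearMap.coe_snd']
  exact ContinuousWithinAt.prodMk (by fun_prop) (by fun_prop)

/-- `J` is a Jacobi field along `γ` with first and second covariant derivatives `DJ` and `DDJ`;
`IsJacobiField` with its witnesses made explicit. -/
structure IsJacobiFieldWith (h : FormField M) (γ : ℝ → M) (I : Set ℝ)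
    (J DJ DDJ : ∀ s, TangentSpace 𝓘(ℝ, E4) (γ s)) : Prop where
  deriv : ∀ t ∈ I, HasCovDerivWithinAt h γ I J t (DJ t)
  deriv₂ : ∀ t ∈ I, HasCovDerivWithinAt h γ I DJ t (DDJ t)
  eqn : ∀ φ ∈ atlas E4 M, ∀ t ∈ I, γ t ∈ φ.source → toChart φ (γ t) (DDJ t) =
    -riemann (coordForm h φ) (φ (γ t)) (toChart φ (γ t) (J t)) (toChart φ (γ t) (velocity γ I t))
      (toChart φ (γ t) (velocity γ I t))

theorem IsJacobiField.exists_isJacobiFieldWith (hJ : IsJacobiField h γ I J) :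
    ∃ DJ DDJ, IsJacobiFieldWith h γ I J DJ DDJ :=
  let ⟨DJ, DDJ, hDJ, hDDJ, heqn⟩ := hJ
  ⟨DJ, DDJ, isCovariantDerivAlong_iff.1 hDJ, isCovariantDerivAlong_iff.1 hDDJ, heqn⟩

theorem IsGeodesicOn.mdifferentiableWithinAt (hγ : IsGeodesicOn h γ I) (ht : t ∈ I) :
    MDifferentiableWithinAt 𝓘(ℝ, ℝ) 𝓘(ℝ, E4) γ I t :=
  (hγ.1 t ht).mdifferentiableWithinAt (by simp)

variable [IsManifold 𝓘(ℝ, E4) ∞ M]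

namespace IsJacobiFieldWith

theorem sub (hL : IsLorentzianOn h univ) (hJ : IsJacobiFieldWith h γ I J DJ DDJ)
    (hK : IsJacobiFieldWith h γ I K DK DDK) :
    IsJacobiFieldWith h γ I (fun s => J s - K s) (fun s => DJ s - DK s)
      (fun s => DDJ s - DDK s) where
  deriv t ht := (hJ.deriv t ht).sub (hK.deriv t ht)
  deriv₂ t ht := (hJ.deriv₂ t ht).sub (hK.deriv₂ t ht)
  eqn φ hφ t ht hx := by
    have hG := hL.isMetricOn isOpen_univ hφ
    have hy := mem_target_inter_preimage_symm hx (mem_univ _)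
    rw [toChart_sub, hJ.eqn φ hφ t ht hx, hK.eqn φ hφ t ht hx, toChart_sub]
    simp only [← hG.tidalL_apply hy, map_sub]
    abel

theorem smul_velocity (hL : IsLorentzianOn h univ) (hγ : IsGeodesicOn h γ I) (β a : ℝ) :
    IsJacobiFieldWith h γ I (fun s => (β * (s - a)) • velocity γ I s)
      (fun s => β • velocity γ I s) (fun _ => 0) where
  deriv t ht := by
    have hβ : HasDerivWithinAt (fun s => β * (s - a)) β I t := by
      simpa using (((hasDerivAt_id t).sub_const a).const_mul β).hasDerivWithinAt
    simpa using (hγ.hasCovDerivWithinAt_velocity ht).smul hβ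
  deriv₂ t ht := by
    simpa using (hγ.hasCovDerivWithinAt_velocity ht).smul (hasDerivWithinAt_const t I β)
  eqn φ hφ t _ hx := by
    have hG := hL.isMetricOn isOpen_univ hφ
    have hy := mem_target_inter_preimage_symm hx (mem_univ _)
    rw [toChart_zero, toChart_smul, ← hG.tidalL_apply hy, map_smul, hG.tidalL_self hy, smul_zero,
      neg_zero]

theorem hasDerivWithinAt_prodMk (hL : IsLorentzianOn h univ)
    (hJ : IsJacobiFieldWith h γ I J DJ DDJ) {φ : OpenPartialHomeomorph M E4}
    (hφ : φ ∈ atlas E4 M) (ht : t ∈ I) (hx : γ t ∈ φ.source) :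
    HasDerivWithinAt (fun s => (toChart φ (γ s) (J s), toChart φ (γ s) (DJ s)))
      (jacobiOperator (coordForm h φ) (φ (γ t)) (toChart φ (γ t) (velocity γ I t))
        (toChart φ (γ t) (J t), toChart φ (γ t) (DJ t))) I t := by
  refine ((hJ.deriv t ht φ hφ hx).prodMk (hJ.deriv₂ t ht φ hφ hx)).congr_deriv ?_
  rw [hJ.eqn φ hφ t ht hx, ← (hL.isMetricOn isOpen_univ hφ).tidalL_apply
    (mem_target_inter_preimage_symm hx (mem_univ _))]
  rfl

theorem eventually_eq_zero_iff (hL : IsLorentzianOn h univ) (hI : I.OrdConnected)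
    (hγ : IsGeodesicOn h γ I) (hJ : IsJacobiFieldWith h γ I J DJ DDJ) (ht : t ∈ I) :
    ∀ᶠ s in 𝓝[I] t, (J s = 0 ∧ DJ s = 0) ↔ (J t = 0 ∧ DJ t = 0) := by
  obtain ⟨φ, hφ, hx⟩ : ∃ φ ∈ atlas E4 M, γ t ∈ φ.source :=
    ⟨_, chart_mem_atlas E4 (γ t), mem_chart_source E4 (γ t)⟩
  have hsource : ∀ᶠ s in 𝓝[I] t, γ s ∈ φ.source :=
    (hγ.mdifferentiableWithinAt ht).continuousWithinAt (φ.open_source.mem_nhds hx)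
  have hA := (hL.isMetricOn isOpen_univ hφ).continuousWithinAt_jacobiOperator
    (mem_target_inter_preimage_symm hx (mem_univ _))
    (hasDerivWithinAt_chart (hγ.mdifferentiableWithinAt ht) hφ hx).continuousWithinAt
    (hγ.hasCovDerivWithinAt_velocity ht φ hφ hx).continuousWithinAt
  have hX : ∀ {s}, γ s ∈ φ.source →
      ((toChart φ (γ s) (J s), toChart φ (γ s) (DJ s)) = 0 ↔ J s = 0 ∧ DJ s = 0) := fun hs => by
    rw [Prod.mk_eq_zero, toChart_eq_zero_iff hφ hs, toChart_eq_zero_iff hφ hs]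
  filter_upwards [hsource, eventually_eq_zero_iff_of_hasDerivWithinAt_clm_apply hI ht hA (by
    filter_upwards [hsource, self_mem_nhdsWithin] with s hs hsI
    exact hJ.hasDerivWithinAt_prodMk hL hφ hsI hs)] with s hs hiff
  rwa [hX hs, hX hx] at hiff

theorem eq_zero (hL : IsLorentzianOn h univ) (hI : I.OrdConnected) (hγ : IsGeodesicOn h γ I)
    (hJ : IsJacobiFieldWith h γ I J DJ DDJ) (ha : a ∈ I) (hJa : J a = 0) (hDJa : DJ a = 0)
    (ht : t ∈ I) : J t = 0 := by
  have hiff : (J t = 0 ∧ DJ t = 0) ↔ (J a = 0 ∧ DJ a = 0) :=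
    hI.isPreconnected.induction₂ (fun r s => (J s = 0 ∧ DJ s = 0) ↔ (J r = 0 ∧ DJ r = 0))
      (fun r hr => hJ.eventually_eq_zero_iff hL hI hγ hr)
      (fun _ _ _ _ _ _ hrs hsu => hsu.trans hrs) (fun _ _ _ _ => Iff.symm) ha ht
  exact (hiff.2 ⟨hJa, hDJa⟩).1

theorem metric_deriv₂ (hJ : IsJacobiFieldWith h γ I J DJ DDJ) (ht : t ∈ I)
    (z : TangentSpace 𝓘(ℝ, E4) (γ t)) :
    h (γ t) (DDJ t) z = -tidalForm h (γ t) (velocity γ I t) (J t) z := by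
  rw [← coordForm_toChart h (chart_mem_atlas E4 (γ t)) (mem_chart_source E4 (γ t)),
    hJ.eqn _ (chart_mem_atlas E4 (γ t)) t ht (mem_chart_source E4 (γ t)), map_neg,
    _root_.neg_apply, tidalForm]

end IsJacobiFieldWith

end Jacobi

/-! ### Functions along a geodesic -/

section Along

variable {M : Type*} [TopologicalSpace M] [ChartedSpace E4 M] {h : FormField M} {U : Set M}
  {f : M → ℝ} {γ : ℝ → M} {I : Set ℝ} {t : ℝ}

theorem IsGeodesicOn.hasDerivWithinAt_comp (hU : IsOpen U)
    (hf : ContMDiffOn 𝓘(ℝ, E4) 𝓘(ℝ, ℝ) ∞ f U) (hγ : IsGeodesicOn h γ I) (ht : t ∈ I)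
    (htU : γ t ∈ U) : HasDerivWithinAt (f ∘ γ) (derivWithin (f ∘ γ) I t) I t :=
  (((hf.contMDiffAt (hU.mem_nhds htU)).mdifferentiableAt (by simp)).comp_mdifferentiableWithinAt t
    (hγ.mdifferentiableWithinAt ht)).differentiableWithinAt.hasDerivWithinAt

variable [IsManifold 𝓘(ℝ, E4) ∞ M]

theorem IsGeodesicOn.hasDerivWithinAt_derivWithin_comp (hU : IsOpen U)
    (hf : ContMDiffOn 𝓘(ℝ, E4) 𝓘(ℝ, ℝ) ∞ f U) (hI : UniqueDiffOn ℝ I) (hγ : IsGeodesicOn h γ I)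
    (ht : t ∈ I) (htU : γ t ∈ U) :
    HasDerivWithinAt (derivWithin (f ∘ γ) I)
      (hessian h f (γ t) (velocity γ I t) (velocity γ I t)) I t := by
  set φ := chartAt E4 (γ t)
  have hφ : φ ∈ atlas E4 M := chart_mem_atlas E4 (γ t)
  have hx : γ t ∈ φ.source := mem_chart_source E4 (γ t)
  have hsource : ∀ᶠ s in 𝓝[I] t, γ s ∈ φ.source :=
    (hγ.mdifferentiableWithinAt ht).continuousWithinAt (φ.open_source.mem_nhds hx)
  have hF : ContDiffAt ℝ 2 (f ∘ φ.symm) (φ (γ t)) :=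
    ((contDiffOn_comp_chartAt_symm hf (γ t)).contDiffAt
      ((φ.symm.isOpen_inter_preimage hU).mem_nhds (mem_target_inter_preimage_symm hx htU))).of_le
      (by norm_cast)
  have hcoord := _root_.hasDerivWithinAt_derivWithin_comp hI ht (c := fun s => φ (γ s)) hF (by
    filter_upwards [hsource, self_mem_nhdsWithin] with s hs hsI
    exact hasDerivWithinAt_chart (hγ.mdifferentiableWithinAt hsI) hφ hs)
    (hγ.hasCovDerivWithinAt_velocity ht φ hφ hx)
  have hcongr : f ∘ γ =ᶠ[𝓝[I] t] fun s => (f ∘ φ.symm) (φ (γ s)) := by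
    filter_upwards [hsource] with s hs
    rw [Function.comp_apply, Function.comp_apply, φ.left_inv hs]
  refine (hcoord.congr_of_eventuallyEq_of_mem hcongr.derivWithin ht).congr_deriv ?_
  rw [toChart_zero, zero_sub, map_neg, ← sub_eq_add_neg]
  rfl

end Along

/-! ### Jacobi fields along null geodesics -/

section NullGeodesic

variable {M : Type*} [TopologicalSpace M] [ChartedSpace E4 M]
  {h : FormField M} {U : Set M} {γ : ℝ → M} {I I₁ : Set ℝ} {a b s t : ℝ} {w w₁ w₂ : ℝ → ℝ}
  {J DJ DDJ K DK DDK : ∀ s, TangentSpace 𝓘(ℝ, E4) (γ s)}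

/-- `γ` is an affinely parametrized null geodesic on the interval `I`, of either time
orientation. -/
structure IsNullGeodesicOn (h : FormField M) (γ : ℝ → M) (I : Set ℝ) : Prop where
  geodesic : IsGeodesicOn h γ I
  null : ∀ t ∈ I, h (γ t) (velocity γ I t) (velocity γ I t) = 0
  velocity_ne_zero : ∀ t ∈ I, velocity γ I t ≠ 0

/-- A Jacobi field, with its covariant derivatives, which is orthogonal to the curve along with
its first derivative. -/
structure IsNormalJacobiFieldWith (h : FormField M) (γ : ℝ → M) (I : Set ℝ)
    (J DJ DDJ : ∀ s, TangentSpace 𝓘(ℝ, E4) (γ s)) : Prop extends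
    IsJacobiFieldWith h γ I J DJ DDJ where
  metric_velocity : ∀ t ∈ I, h (γ t) (J t) (velocity γ I t) = 0
  metric_deriv_velocity : ∀ t ∈ I, h (γ t) (DJ t) (velocity γ I t) = 0

/-- On the parameters in `I₁ ⊆ I` the tidal operator `v ↦ R(v, γ') γ'` acts on the vectors
orthogonal to `γ'`, modulo `γ'`, as the scalar `-w₂ / w`, where `w` is a positive function with
derivatives `w₁` and `w₂`. -/
structure IsScalarTidal (h : FormField M) (γ : ℝ → M) (I I₁ : Set ℝ) (w w₁ w₂ : ℝ → ℝ) : Prop where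
  pos : ∀ t ∈ I₁, 0 < w t
  deriv : ∀ t ∈ I₁, HasDerivWithinAt w (w₁ t) I t
  deriv₂ : ∀ t ∈ I₁, HasDerivWithinAt w₁ (w₂ t) I t
  tidal : ∀ t ∈ I₁, ∀ v z, h (γ t) v (velocity γ I t) = 0 → h (γ t) z (velocity γ I t) = 0 →
    w t * tidalForm h (γ t) (velocity γ I t) v z = -(w₂ t * h (γ t) v z)

/-- The field `w J' - w' J` along `γ`, where `w₁` and `DJ` stand for the derivatives of `w` and
`J`. -/
def wronskianField (w w₁ : ℝ → ℝ) (J DJ : ∀ s, TangentSpace 𝓘(ℝ, E4) (γ s)) (s : ℝ) :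
    TangentSpace 𝓘(ℝ, E4) (γ s) :=
  w s • DJ s - w₁ s • J s

theorem IsConjugate.uniqueDiffOn (hI : Convex ℝ I) (hab : IsConjugate h γ I a b) :
    UniqueDiffOn ℝ I :=
  uniqueDiffOn_convex hI (hI.nontrivial_iff_nonempty_interior.1
    ⟨a, hab.1, b, hab.2.1, hab.2.2.1⟩)

theorem IsNormalJacobiFieldWith.metric_wronskianField_velocity
    (hJ : IsNormalJacobiFieldWith h γ I J DJ DDJ) (w w₁ : ℝ → ℝ) (ht : t ∈ I) :
    h (γ t) (wronskianField w w₁ J DJ t) (velocity γ I t) = 0 := by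
  rw [wronskianField, map_sub, map_smul, map_smul, _root_.sub_apply, _root_.smul_apply,
    _root_.smul_apply, hJ.metric_velocity t ht, hJ.metric_deriv_velocity t ht, smul_zero,
    smul_zero, sub_zero]

theorem IsScalarTidal.hasCovDerivWithinAt_wronskianField (hT : IsScalarTidal h γ I I₁ w w₁ w₂)
    (hI₁ : I₁ ⊆ I) (hJ : IsJacobiFieldWith h γ I J DJ DDJ) (ht : t ∈ I₁) :
    HasCovDerivWithinAt h γ I (wronskianField w w₁ J DJ) t (w t • DDJ t - w₂ t • J t) := by
  have hV := ((hJ.deriv₂ t (hI₁ ht)).smul (hT.deriv t ht)).sub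
    ((hJ.deriv t (hI₁ ht)).smul (hT.deriv₂ t ht))
  rwa [add_comm (w₁ t • DJ t), add_sub_add_right_eq_sub] at hV

variable [IsManifold 𝓘(ℝ, E4) ∞ M]

theorem IsScalarTidal.metric_smul_sub_eq_zero (hT : IsScalarTidal h γ I I₁ w w₁ w₂)
    (hI₁ : I₁ ⊆ I) (hJ : IsNormalJacobiFieldWith h γ I J DJ DDJ) (ht : t ∈ I₁)
    {z : TangentSpace 𝓘(ℝ, E4) (γ t)} (hz : h (γ t) z (velocity γ I t) = 0) :
    h (γ t) (w t • DDJ t - w₂ t • J t) z = 0 := by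
  rw [map_sub, map_smul, map_smul, _root_.sub_apply, _root_.smul_apply, _root_.smul_apply,
    hJ.metric_deriv₂ (hI₁ ht), smul_eq_mul, smul_eq_mul, mul_neg,
    hT.tidal t ht _ _ (hJ.metric_velocity t (hI₁ ht)) hz, neg_neg, sub_self]

theorem IsGloballyConformallyFlatOn.exists_isScalarTidal (hL : IsLorentzianOn h univ)
    (hU : IsOpen U) (hflat : IsGloballyConformallyFlatOn h U) (hI : UniqueDiffOn ℝ I)
    (hγ : IsNullGeodesicOn h γ I) (hI₁ : I₁ ⊆ I) (hγU : ∀ t ∈ I₁, γ t ∈ U) :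
    ∃ w w₁ w₂, IsScalarTidal h γ I I₁ w w₁ w₂ := by
  obtain ⟨Ω, η, hΩ, hΩ0, hη, hηflat, hc⟩ := hflat
  exact ⟨_, _, _, fun t ht => hΩ0 _ (hγU t ht),
    fun t ht => hγ.geodesic.hasDerivWithinAt_comp hU hΩ (hI₁ ht) (hγU t ht),
    fun t ht => hγ.geodesic.hasDerivWithinAt_derivWithin_comp hU hΩ hI (hI₁ ht) (hγU t ht),
    fun t ht v z hv hz => mul_tidalForm_of_conformallyFlat hU (hL.mono (subset_univ U)) hΩ hΩ0 hη
      hηflat hc (hγU t ht) (hγ.null t (hI₁ ht)) hv ((hL.symm _ (mem_univ _) _ _).trans hz)⟩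

namespace IsJacobiFieldWith

theorem metric_deriv_velocity_eq (hL : IsLorentzianOn h univ) (hI : Convex ℝ I)
    (hγ : IsGeodesicOn h γ I) (hJ : IsJacobiFieldWith h γ I J DJ DDJ) (hs : s ∈ I) (ht : t ∈ I) :
    h (γ s) (DJ s) (velocity γ I s) = h (γ t) (DJ t) (velocity γ I t) := by
  refine eq_of_hasDerivWithinAt_zero hI (f := fun s => h (γ s) (DJ s) (velocity γ I s))
    (fun r hr => ?_) hs ht
  refine ((hJ.deriv₂ r hr).hasDerivWithinAt_metric hL (hγ.mdifferentiableWithinAt hr)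
    (hγ.hasCovDerivWithinAt_velocity hr)).congr_deriv ?_
  rw [hJ.metric_deriv₂ hr, hL.tidalForm_self_right isOpen_univ (mem_univ _), neg_zero, map_zero,
    add_zero]

theorem isNormalJacobiFieldWith (hL : IsLorentzianOn h univ) (hI : Convex ℝ I)
    (hγ : IsGeodesicOn h γ I) (hJ : IsJacobiFieldWith h γ I J DJ DDJ) (ha : a ∈ I) (hb : b ∈ I)
    (hab : a ≠ b) (hJa : J a = 0) (hJb : J b = 0) : IsNormalJacobiFieldWith h γ I J DJ DDJ := by
  have hderiv : ∀ t ∈ I, HasDerivWithinAt (fun s => h (γ s) (J s) (velocity γ I s))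
      (h (γ t) (DJ t) (velocity γ I t)) I t := fun t ht => by
    refine ((hJ.deriv t ht).hasDerivWithinAt_metric hL (hγ.mdifferentiableWithinAt ht)
      (hγ.hasCovDerivWithinAt_velocity ht)).congr_deriv ?_
    rw [map_zero, add_zero]
  obtain ⟨c, hc, hDJc⟩ := exists_hasDerivWithinAt_eq_zero hI hderiv ha hb hab (by simp [hJa, hJb])
  have hDJ : ∀ t ∈ I, h (γ t) (DJ t) (velocity γ I t) = 0 := fun t ht =>
    (hJ.metric_deriv_velocity_eq hL hI hγ ht hc).trans hDJc
  refine ⟨hJ, fun t ht => ?_, hDJ⟩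
  have hconst := eq_of_hasDerivWithinAt_zero hI
    (fun s hs => (hderiv s hs).congr_deriv (hDJ s hs)) ht ha
  simpa only [hJa, map_zero, _root_.zero_apply] using hconst

theorem metric_deriv_comm (hL : IsLorentzianOn h univ) (hI : Convex ℝ I)
    (hγ : IsGeodesicOn h γ I) (hJ : IsJacobiFieldWith h γ I J DJ DDJ)
    (hK : IsJacobiFieldWith h γ I K DK DDK) (ha : a ∈ I) (hJa : J a = 0) (hKa : K a = 0)
    (ht : t ∈ I) : h (γ t) (DJ t) (K t) = h (γ t) (J t) (DK t) := by
  have hconst := eq_of_hasDerivWithinAt_zero hI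
    (f := fun s => h (γ s) (DJ s) (K s) - h (γ s) (J s) (DK s)) (fun r hr => ?_) ht ha
  · simpa only [hJa, hKa, map_zero, _root_.zero_apply, sub_zero, sub_eq_zero] using hconst
  · have hγr := hγ.mdifferentiableWithinAt hr
    refine (((hJ.deriv₂ r hr).hasDerivWithinAt_metric hL hγr (hK.deriv r hr)).sub
      ((hJ.deriv r hr).hasDerivWithinAt_metric hL hγr (hK.deriv₂ r hr))).congr_deriv ?_
    rw [hJ.metric_deriv₂ hr, hL.symm _ (mem_univ _) (J r), hK.metric_deriv₂ hr,
      hL.tidalForm_comm isOpen_univ (mem_univ _)]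
    ring

theorem eq_zero_of_metric_deriv_self_eq_zero (hL : IsLorentzianOn h univ) (hI : Convex ℝ I)
    (hγ : IsNullGeodesicOn h γ I) (hJ : IsJacobiFieldWith h γ I J DJ DDJ) (ha : a ∈ I)
    (hb : b ∈ I) (hab : a ≠ b) (hJa : J a = 0) (hJb : J b = 0)
    (hDJ : h (γ b) (DJ b) (DJ b) = 0) (ht : t ∈ I) : J t = 0 := by
  have hDJk := (hJ.isNormalJacobiFieldWith hL hI hγ.geodesic ha hb hab hJa
    hJb).metric_deriv_velocity b hb
  obtain ⟨e, he⟩ := hL.exists_isLorentzBasis (mem_univ (γ b))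
  obtain ⟨β, hβ⟩ := he.eq_smul_of_null (hγ.velocity_ne_zero b hb) (hγ.null b hb) hDJ
    ((hL.symm _ (mem_univ _) _ _).trans hDJk) hDJk
  have hJβ : ∀ s ∈ I, J s = (β * (s - b)) • velocity γ I s := fun s hs =>
    sub_eq_zero.1 ((hJ.sub hL (smul_velocity hL hγ.geodesic β b)).eq_zero hL hI.ordConnected
      hγ.geodesic hb (by rw [hJb, sub_self, mul_zero, zero_smul, sub_zero])
      (sub_eq_zero.2 hβ) hs)
  have hβ0 : β = 0 := by
    have hβa := ((hJβ a ha).symm.trans hJa)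
    rw [smul_eq_zero, mul_eq_zero] at hβa
    exact (hβa.resolve_right (hγ.velocity_ne_zero a ha)).resolve_right (sub_ne_zero.2 hab)
  rw [hJβ t ht, hβ0, zero_mul, zero_smul]

end IsJacobiFieldWith

namespace IsScalarTidal

theorem metric_wronskianField_eq (hT : IsScalarTidal h γ I I₁ w w₁ w₂)
    (hL : IsLorentzianOn h univ) (hγ : IsGeodesicOn h γ I) (hI₁ : I₁ ⊆ I) (hI₁c : Convex ℝ I₁)
    (hJ : IsNormalJacobiFieldWith h γ I J DJ DDJ) (hK : IsNormalJacobiFieldWith h γ I K DK DDK)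
    (hs : s ∈ I₁) (ht : t ∈ I₁) :
    h (γ s) (wronskianField w w₁ J DJ s) (wronskianField w w₁ K DK s) =
      h (γ t) (wronskianField w w₁ J DJ t) (wronskianField w w₁ K DK t) := by
  refine eq_of_hasDerivWithinAt_zero hI₁c
    (f := fun s => h (γ s) (wronskianField w w₁ J DJ s) (wronskianField w w₁ K DK s))
    (fun r hr => ?_) hs ht
  refine (((hT.hasCovDerivWithinAt_wronskianField hI₁ hJ.1 hr).hasDerivWithinAt_metric hL
    (hγ.mdifferentiableWithinAt (hI₁ hr))
    (hT.hasCovDerivWithinAt_wronskianField hI₁ hK.1 hr)).mono hI₁).congr_deriv ?_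
  rw [hL.symm _ (mem_univ _) (wronskianField w w₁ J DJ r),
    hT.metric_smul_sub_eq_zero hI₁ hJ hr (hK.metric_wronskianField_velocity w w₁ (hI₁ hr)),
    hT.metric_smul_sub_eq_zero hI₁ hK hr (hJ.metric_wronskianField_velocity w w₁ (hI₁ hr)),
    add_zero]

theorem hasDerivWithinAt_metric_wronskianField_div (hT : IsScalarTidal h γ I I₁ w w₁ w₂)
    (hL : IsLorentzianOn h univ) (hγ : IsGeodesicOn h γ I) (hI₁ : I₁ ⊆ I)
    (hJ : IsNormalJacobiFieldWith h γ I J DJ DDJ) (hK : IsNormalJacobiFieldWith h γ I K DK DDK)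
    (ht : t ∈ I₁) :
    HasDerivWithinAt (fun s => h (γ s) (wronskianField w w₁ J DJ s) (K s) / w s)
      (h (γ t) (wronskianField w w₁ J DJ t) (wronskianField w w₁ K DK t) / w t ^ 2) I t := by
  have hV := (hT.hasCovDerivWithinAt_wronskianField hI₁ hJ.1 ht).hasDerivWithinAt_metric hL
    (hγ.mdifferentiableWithinAt (hI₁ ht)) (hK.deriv t (hI₁ ht))
  rw [hT.metric_smul_sub_eq_zero hI₁ hJ ht (hK.metric_velocity t (hI₁ ht)), zero_add] at hV
  refine (hV.fun_div (hT.deriv t ht) (hT.pos t ht).ne').congr_deriv ?_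
  rw [wronskianField.eq_1 w w₁ K, map_sub, map_smul, map_smul, smul_eq_mul, smul_eq_mul]
  ring

theorem metric_wronskianField_eq_zero (hT : IsScalarTidal h γ I I₁ w w₁ w₂)
    (hL : IsLorentzianOn h univ) (hI : Convex ℝ I) (hγ : IsGeodesicOn h γ I) (hI₁ : I₁ ⊆ I)
    (hI₁c : Convex ℝ I₁) (hJ : IsNormalJacobiFieldWith h γ I J DJ DDJ)
    (hK : IsNormalJacobiFieldWith h γ I K DK DDK) (ha : a ∈ I) (hJa : J a = 0) (hKa : K a = 0)
    {b c : ℝ} (hb : b ∈ I₁) (hc : c ∈ I₁) (hbc : b ≠ c) (hJb : J b = 0) (hKc : K c = 0)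
    (ht : t ∈ I₁) :
    h (γ t) (wronskianField w w₁ J DJ t) (wronskianField w w₁ K DK t) = 0 := by
  have hDJK : h (γ b) (DJ b) (K b) = 0 := by
    rw [hJ.metric_deriv_comm hL hI hγ hK.1 ha hJa hKa (hI₁ hb), hJb, map_zero, _root_.zero_apply]
  obtain ⟨r, hr, hr0⟩ := exists_hasDerivWithinAt_eq_zero hI₁c (fun s hs =>
    (hT.hasDerivWithinAt_metric_wronskianField_div hL hγ hI₁ hJ hK hs).mono hI₁) hb hc hbc (by
      simp [wronskianField, hJb, hKc, hDJK])
  rw [hT.metric_wronskianField_eq hL hγ hI₁ hI₁c hJ hK ht hr]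
  exact (div_eq_zero_iff.1 hr0).resolve_right (pow_ne_zero 2 (hT.pos r hr).ne')

theorem eq_zero_of_metric_wronskianField_self_eq_zero (hT : IsScalarTidal h γ I I₁ w w₁ w₂)
    (hL : IsLorentzianOn h univ) (hI : Convex ℝ I) (hγ : IsNullGeodesicOn h γ I) (hI₁ : I₁ ⊆ I)
    (hI₁c : Convex ℝ I₁) (hJ : IsNormalJacobiFieldWith h γ I J DJ DDJ) (ha : a ∈ I)
    (hb : b ∈ I₁) (hab : a ≠ b) (hJa : J a = 0) (hJb : J b = 0) (hs : s ∈ I₁)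
    (hV : h (γ s) (wronskianField w w₁ J DJ s) (wronskianField w w₁ J DJ s) = 0) (ht : t ∈ I) :
    J t = 0 := by
  refine hJ.eq_zero_of_metric_deriv_self_eq_zero hL hI hγ ha (hI₁ hb) hab hJa hJb ?_ ht
  rw [hT.metric_wronskianField_eq hL hγ.geodesic hI₁ hI₁c hJ hJ hs hb] at hV
  simpa [wronskianField, hJb, (hT.pos b hb).ne'] using hV

end IsScalarTidal

theorem IsConjugate.exists_isNormalJacobiFieldWith (hL : IsLorentzianOn h univ) (hI : Convex ℝ I)
    (hγ : IsGeodesicOn h γ I) (hab : IsConjugate h γ I a b) :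
    ∃ J DJ DDJ, IsNormalJacobiFieldWith h γ I J DJ DDJ ∧ J a = 0 ∧ J b = 0 ∧ ∃ t ∈ I, J t ≠ 0 := by
  obtain ⟨ha, hb, hne, J, hJ, hJa, hJb, hJ0⟩ := hab
  obtain ⟨DJ, DDJ, hJ⟩ := hJ.exists_isJacobiFieldWith
  exact ⟨J, DJ, DDJ, hJ.isNormalJacobiFieldWith hL hI hγ ha hb hne hJa hJb, hJa, hJb, hJ0⟩

theorem IsScalarTidal.not_injective_of_isConjugate (hT : IsScalarTidal h γ I I₁ w w₁ w₂)
    (hL : IsLorentzianOn h univ) (hI : Convex ℝ I) (hγ : IsNullGeodesicOn h γ I) (hI₁ : I₁ ⊆ I)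
    (hI₁c : Convex ℝ I₁) {τ : Fin 3 → ℝ} (hτI : ∀ i, τ i ∈ I₁)
    (hτ : ∀ i, IsConjugate h γ I a (τ i)) : ¬ Function.Injective τ := by
  intro hinj
  choose J DJ DDJ hJ hJa hJτ hJ0 using fun i =>
    (hτ i).exists_isNormalJacobiFieldWith hL hI hγ.geodesic
  set s := τ 0
  have hs : s ∈ I₁ := hτI 0
  have hVk : ∀ i, h (γ s) (velocity γ I s) (wronskianField w w₁ (J i) (DJ i) s) = 0 := fun i =>
    (hL.symm _ (mem_univ _) _ _).trans ((hJ i).metric_wronskianField_velocity w w₁ (hI₁ hs))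
  have hVV : (h (γ s)).toBilinForm.IsOrthoᵢ fun i => wronskianField w w₁ (J i) (DJ i) s :=
    fun i j hij => hT.metric_wronskianField_eq_zero hL hI hγ.geodesic hI₁ hI₁c (hJ i) (hJ j)
      (hτ i).1 (hJa i) (hJa j) (hτI i) (hτI j) (hinj.ne hij) (hJτ i) (hJτ j) hs
  obtain ⟨i, hi⟩ := exists_apply_self_eq_zero_of_isOrthoᵢ (hL.separatingLeft (mem_univ (γ s)))
    finrank_euclideanSpace_fin (hγ.velocity_ne_zero s (hI₁ hs)) (hγ.null s (hI₁ hs)) hVk hVV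
  obtain ⟨t, ht, hJt⟩ := hJ0 i
  exact hJt (hT.eq_zero_of_metric_wronskianField_self_eq_zero hL hI hγ hI₁ hI₁c (hJ i) (hτ i).1
    (hτI i) (hτ i).2.2.1 (hJa i) (hJτ i) hs hi ht)

theorem theorem1_general (hL : IsLorentzianOn h univ) (hU : IsOpen U)
    (hflat : IsGloballyConformallyFlatOn h U) (hI : Convex ℝ I) (hγ : IsNullGeodesicOn h γ I)
    (hI₁ : I₁ ⊆ I) (hI₁c : Convex ℝ I₁) (hγU : ∀ t ∈ I₁, γ t ∈ U) (a : ℝ) :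
    {t ∈ I₁ | IsConjugate h γ I a t}.encard ≤ 2 := by
  by_contra! hcard
  obtain ⟨T, hT, hT3⟩ := exists_subset_encard_eq (Order.add_one_le_of_lt hcard)
  obtain ⟨x, y, z, hxy, hxz, hyz, rfl⟩ := encard_eq_three.1 hT3
  have hmem : ∀ i, ![x, y, z] i ∈ {t ∈ I₁ | IsConjugate h γ I a t} := fun i => hT (by
    fin_cases i <;> simp)
  obtain ⟨w, w₁, w₂, htidal⟩ := hflat.exists_isScalarTidal hL hU ((hmem 0).2.uniqueDiffOn hI)
    hγ hI₁ hγU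
  exact htidal.not_injective_of_isConjugate hL hI hγ hI₁ hI₁c (fun i => (hmem i).1)
    (fun i => (hmem i).2) (by simp [Function.Injective, Fin.forall_fin_succ, *, Ne.symm])

end NullGeodesic

/-! ### Wandering null geodesics -/

section Wandering

variable {M : Type*} [TopologicalSpace M] [ChartedSpace E4 M] [IsManifold 𝓘(ℝ, E4) ∞ M]
  {S : Spacetime M} {γ σ : ℝ → M} {U : Set M}

theorem IsCompleteFutureNullGeodesic.isNullGeodesicOn (hγ : IsCompleteFutureNullGeodesic S γ) :
    IsNullGeodesicOn S.metric γ (Ici 0) where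
  geodesic := hγ.geodesic
  null := hγ.null
  velocity_ne_zero t ht hzero := (hγ.future t ht).ne (by
    rw [hzero, map_zero, _root_.zero_apply])

theorem IsTruncatedFutureWandering.exists_infinite_conjugateParams
    (hσ : IsTruncatedFutureWandering S σ) (hσU : ∀ s ∈ Ici (0 : ℝ), σ s ∈ U) :
    ∃ γ t₁, IsNullGeodesicOn S.metric γ (Ici 0) ∧ 0 ≤ t₁ ∧ (∀ t ∈ Ici t₁, γ t ∈ U) ∧
      {t ∈ Ici t₁ | IsConjugate S.metric γ (Ici 0) 0 t}.Infinite := by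
  obtain ⟨γ, t₁, ⟨hγ, hinf⟩, hleast, hσγ⟩ := hσ
  refine ⟨γ, t₁, hγ.isNullGeodesicOn, hleast.1.2.1, fun t ht => ?_,
    hinf.mono fun t ht => ⟨hleast.2 ht, ht⟩⟩
  have ht0 : t - t₁ ∈ Ici (0 : ℝ) := mem_Ici.2 (sub_nonneg.2 ht)
  simpa only [hσγ _ ht0, add_sub_cancel] using hσU _ ht0

end Wandering

end

theorem theorem1 {M : Type*} [TopologicalSpace M] [T2Space M] [ChartedSpace E4 M]
    [IsManifold 𝓘(ℝ, E4) ∞ M] (S : Spacetime M) (U : Set M) (hU : IsOpen U)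
    (hflat : IsGloballyConformallyFlatOn S.metric U) :
    ¬ ∃ σ : ℝ → M, IsTruncatedFutureWandering S σ ∧ ∀ s ∈ Ici (0 : ℝ), σ s ∈ U := by
  rintro ⟨σ, hσ, hσU⟩
  obtain ⟨γ, t₁, hγ, ht₁, hγU, hinf⟩ := hσ.exists_infinite_conjugateParams hσU
  exact hinf (finite_of_encard_le_coe (theorem1_general S.lorentzian hU hflat (convex_Ici 0) hγ
    (Ici_subset_Ici.2 ht₁) (convex_Ici t₁) hγU 0))
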